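/- Let $d\ge 1$, $T=[0,1]^d$, $\alpha>0$, $L>0$, $0<\beta_0\le 1$, $C_Z>0$ and $\sigma_0^2>0$. Write $\lfloor\alpha\rfloor=\max\{k\in\mathbb N_0 : k<\alpha\}$ and let $\mathcal H(\alpha,L)$ be the set of functions $\mu:T\to\mathbb R$ whose partial derivatives $\partial^{b}\mu$, $|b|\le\lfloor\alpha\rfloor$, exist on $T$ and satisfy $$\max_{|b|\le\lfloor\alpha\rfloor}\sup_{x\in T}|\partial^{b}\mu(x)|+\max_{|b|=\lfloor\alpha\rfloor}\ \sup_{x\ne y\in T}\frac{|\partial^{b}\mu(x)-\partial^{b}\mu(y)|}{\|x-y\|_\infty^{\alpha-\lfloor\alpha\rfloor}}\le L .$$ Let $\mathcal P_T(\beta_0,C_Z)$ be the class of centered, square integrable real random fields $Z$ on $T$ for which there are $\beta\in[\beta_0,1]$ and a random variable $M>0$ with $\mathbb E[M^2]+\mathbb E[Z(0)^2]\le C_Z$ such that almost surely $|Z(x)-Z(y)|\le M\|x-y\|_\infty^{\beta}$ for all $x,y\in T$. Let $f_1,\dots,f_d:[0,1]\to\mathbb R$ be Lipschitz continuous probability densities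 with $0<f_{k,\min}\le f_k\le f_{k,\max}<\infty$. For $p=(p_1,\dots,p_d)$ with positive integers $p_k$ let $x_{k,l}\in[0,1]$ be given by $$\int_0^{x_{k,l}}f_k(t)\,dt=\frac{l-0.5}{p_k},\qquad l=1,\dots,p_k,\quad k=1,\dots,d,$$ and put $x_j=(x_{1,j_1},\dots,x_{d,j_d})$ for $1\le j_k\le p_k$. One observes $$Y_{i,j}=\mu(x_j)+Z_i(x_j)+\varepsilon_{i,j},\qquad i=1,\dots,n,\quad 1\le j_k\le p_k\ (k=1,\dots,d),$$ where $Z_1,\dots,Z_n$ are independent copies of $Z$ and the $\varepsilon_{i,j}$ are i.i.d. $\mathcal N(0,\sigma_0^2)$, independent of $Z_1,\dots,Z_n$. With $p_{\min}=\min_k p_k$ and $p^{1}=\prod_{k=1}^d p_k$ set $$a_{n,p}=\max\Big\{p_{\min}^{-\alpha},\ \Big(\frac{\log(n\,p^{1})}{n\,p^{1}}\Big)^{\frac{\alpha}{2\alpha+d}},\ n^{-1/2}\Big\}.$$ Then there is a constant $c>0$ such that $$\liminf_{n\to\infty,\ p_{\min}\to\infty}\ \inf_{\hat\mu}\ \sup_{\mu\in\mathcal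 H(\alpha,L),\ Z\in\mathcal P_T(\beta_0,C_Z)}\ \mathbb E_{\mu,Z}\Big[a_{n,p}^{-1}\,\sup_{x\in T}|\hat\mu(x)-\mu(x)|\Big]\ \ge\ c ,$$ where the infimum is over all estimators $\hat\mu$, i.e. all real functions on $T$ each of whose values is a measurable function of the observations $(Y_{i,j})$. -/

import Mathlib

open MeasureTheory ProbabilityTheory Filter
open scoped ENNReal NNReal

noncomputable section

namespace FDAMean

/-- The hypercube `T = [0,1]^d`. Functions on `T` are represented by total functions on
`Fin d → ℝ`; no definition below looks at their values outside `T`. The norm of `Fin d → ℝ` is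
the maximum norm. -/
abbrev cube (d : ℕ) : Set (Fin d → ℝ) := Set.Icc 0 1

/-! ### Hölder classes -/

/-- The largest natural number that is strictly smaller than `α` (for `α > 0`). -/
def strictFloor (α : ℝ) : ℕ := ⌈α⌉₊ - 1

theorem strictFloor_isGreatest {α : ℝ} (hα : 0 < α) :
    IsGreatest {k : ℕ | (k : ℝ) < α} (strictFloor α) := by
  have h1 : 0 < ⌈α⌉₊ := Nat.ceil_pos.mpr hα
  refine ⟨?_, fun k hk => ?_⟩
  · have h2 : strictFloor α < ⌈α⌉₊ := by
      unfold strictFloor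
      omega
    exact Nat.lt_ceil.mp h2
  · have : k < ⌈α⌉₊ := Nat.lt_ceil.mpr hk
    unfold strictFloor
    omega

/-- The partial derivative in direction `k` of a function on the cube (one-sided on the faces). -/
def partialDeriv {d : ℕ} (k : Fin d) (f : (Fin d → ℝ) → ℝ) : (Fin d → ℝ) → ℝ :=
  fun x => derivWithin (fun t : ℝ => f (Function.update x k t)) (Set.Icc 0 1) (x k)

/-- The partial derivative in direction `k` exists at every point of the cube. -/
def HasPartialDeriv {d : ℕ} (k : Fin d) (f : (Fin d → ℝ) → ℝ) : Prop :=
  ∀ x ∈ cube d, DifferentiableWithinAt ℝ (fun t : ℝ => f (Function.update x k t))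
    (Set.Icc 0 1) (x k)

/-- `∂^b f = ∂₁^{b₁} ⋯ ∂_d^{b_d} f`. -/
def multiDeriv {d : ℕ} (b : Fin d → ℕ) (f : (Fin d → ℝ) → ℝ) : (Fin d → ℝ) → ℝ :=
  (List.finRange d).foldr (fun k g => (partialDeriv k)^[b k] g) f

/-- All partial derivatives of `f` on the cube up to order `m` exist. -/
def HasDerivsUpTo {d : ℕ} (m : ℕ) (f : (Fin d → ℝ) → ℝ) : Prop :=
  ∀ b : Fin d → ℕ, ∑ k, b k < m → ∀ k, HasPartialDeriv k (multiDeriv b f)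

/-- The Hölder norm of index `α` on the cube, with value `∞` allowed. -/
def holderNorm {d : ℕ} (α : ℝ) (f : (Fin d → ℝ) → ℝ) : ℝ≥0∞ :=
  (⨆ (b : Fin d → ℕ) (_ : ∑ k, b k ≤ strictFloor α) (x ∈ cube d), ‖multiDeriv b f x‖ₑ) +
  ⨆ (b : Fin d → ℕ) (_ : ∑ k, b k = strictFloor α) (x ∈ cube d) (y ∈ cube d) (_ : x ≠ y),
    ‖multiDeriv b f x - multiDeriv b f y‖ₑ / ENNReal.ofReal (‖x - y‖ ^ (α - strictFloor α))

/-- The Hölder class `H_T(α, L)`. -/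
def holderClass (d : ℕ) (α L : ℝ) : Set ((Fin d → ℝ) → ℝ) :=
  {f | HasDerivsUpTo (strictFloor α) f ∧ holderNorm α f ≤ ENNReal.ofReal L}

/-! ### The random fields -/

/-- A real random field on the cube. -/
structure RandomField (d : ℕ) where
  Ω : Type
  [mΩ : MeasurableSpace Ω]
  P : Measure Ω
  [isProb : IsProbabilityMeasure P]
  Z : (Fin d → ℝ) → Ω → ℝ
  meas : ∀ x ∈ cube d, Measurable (Z x)

attribute [instance] RandomField.mΩ RandomField.isProb

/-- The class `P_T(β₀, C_Z)` of centered, square integrable random fields with Hölder continuous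
paths. -/
def processClass (d : ℕ) (β₀ C_Z : ℝ) : Set (RandomField d) :=
  {Z | (∀ x ∈ cube d, MemLp (Z.Z x) 2 Z.P ∧ ∫ ω, Z.Z x ω ∂Z.P = 0) ∧
    ∃ β ∈ Set.Icc β₀ 1, ∃ M : Z.Ω → ℝ,
      Measurable M ∧ (∀ ω, 0 < M ω) ∧ MemLp M 2 Z.P ∧
      ∫ ω, M ω ^ 2 ∂Z.P + ∫ ω, Z.Z 0 ω ^ 2 ∂Z.P ≤ C_Z ∧
      ∀ᵐ ω ∂Z.P, ∀ x ∈ cube d, ∀ y ∈ cube d,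
        |Z.Z x ω - Z.Z y ω| ≤ M ω * ‖x - y‖ ^ β}

/-! ### The design -/

/-- `f` is a Lipschitz continuous probability density on `[0,1]` bounded away from `0` and `∞`. -/
structure IsDesignDensity (f : ℝ → ℝ) : Prop where
  lipschitz : ∃ K : ℝ≥0, LipschitzOnWith K f (Set.Icc 0 1)
  bounds : ∃ fmin fmax : ℝ, 0 < fmin ∧ ∀ t ∈ Set.Icc (0 : ℝ) 1, fmin ≤ f t ∧ f t ≤ fmax
  integral_eq_one : ∫ t in (0 : ℝ)..1, f t = 1

/-- The multi-indices `1 ≤ j ≤ p`, counted from `0` in each coordinate. -/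
abbrev GridIndex {d : ℕ} (p : Fin d → ℕ) : Type := ∀ k, Fin (p k)

/-- The coordinates `x k l` of a design with `p k` points in direction `k` are the
`(l - 0.5) / p k` quantiles of the density `f k`, `l = 1, …, p k` (here `l` counts from `0`). -/
def IsDesign {d : ℕ} (f : Fin d → ℝ → ℝ) (p : Fin d → ℕ) (x : ∀ k, Fin (p k) → ℝ) : Prop :=
  ∀ (k : Fin d) (l : Fin (p k)), x k l ∈ Set.Icc (0 : ℝ) 1 ∧
    ∫ t in (0 : ℝ)..(x k l), f k t = (((l : ℕ) : ℝ) + 1 - 0.5) / (p k : ℝ)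

/-- The point `x_j` of the Cartesian product design. -/
def gridPoint {d : ℕ} {p : Fin d → ℕ} (x : ∀ k, Fin (p k) → ℝ) (j : GridIndex p) : Fin d → ℝ :=
  fun k => x k (j k)

/-! ### Model, estimators and risk -/

/-- The observations `(Y_{i,j})`. -/
abbrev Obs (n : ℕ) {d : ℕ} (p : Fin d → ℕ) : Type := Fin n → GridIndex p → ℝ

/-- The law of `Y_{i,j} = μ(x_j) + Z_i(x_j) + ε_{i,j}` with `Z_1, …, Z_n` independent copies of `Z`
and, independently of these, `ε_{i,j}` i.i.d. `N(0, v)`. -/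
def obsLaw {d : ℕ} (n : ℕ) {p : Fin d → ℕ} (x : ∀ k, Fin (p k) → ℝ) (v : ℝ≥0)
    (μ : (Fin d → ℝ) → ℝ) (Z : RandomField d) : Measure (Obs n p) :=
  ((Measure.pi fun _ : Fin n => Z.P).prod
      (Measure.pi fun _ : Fin n => Measure.pi fun _ : GridIndex p => gaussianReal 0 v)).map
    fun q i j => μ (gridPoint x j) + Z.Z (gridPoint x j) (q.1 i) + q.2 i j

/-- Estimators of a function on the cube: every value is a measurable function of the data. -/
def estimators (n : ℕ) {d : ℕ} (p : Fin d → ℕ) : Set (Obs n p → (Fin d → ℝ) → ℝ) :=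
  {m | ∀ x ∈ cube d, Measurable fun y => m y x}

/-- The supremum distance `‖f - g‖_∞` on the cube, with value `∞` allowed. -/
def supDist {d : ℕ} (f g : (Fin d → ℝ) → ℝ) : ℝ≥0∞ := ⨆ x ∈ cube d, ‖f x - g x‖ₑ

/-- The rate `a_{n,p}`. -/
def rate {d : ℕ} (α : ℝ) (n : ℕ) (p : Fin d → ℕ) : ℝ :=
  max (((⨅ k, p k : ℕ) : ℝ) ^ (-α))
    (max ((Real.log (n * ∏ k, (p k : ℝ)) / (n * ∏ k, (p k : ℝ))) ^ (α / (2 * α + d)))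
      ((n : ℝ) ^ (-(1 / 2) : ℝ)))

/-- The minimax risk for the supremum norm, normalised by the rate. -/
def minimaxRisk {d : ℕ} (α L β₀ C_Z : ℝ) (v : ℝ≥0) (n : ℕ) (p : Fin d → ℕ)
    (x : ∀ k, Fin (p k) → ℝ) : ℝ≥0∞ :=
  ⨅ m ∈ estimators n p, ⨆ μ ∈ holderClass d α L, ⨆ Z ∈ processClass d β₀ C_Z,
    ∫⁻ y, (ENNReal.ofReal (rate α n p))⁻¹ * supDist (m y) μ ∂(obsLaw n x v μ Z)

end FDAMean

end

/-!
The null hypothesis is `μ = 0`, `Z = 0`. If a measure `ν` of total mass bounded below is dominated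
both by the null law of the observations and by an average of laws with mean functions `μ_k` such
that `|μ_k (z_k)| ≥ δ`, then no estimator has maximal risk of smaller order than `δ`: under `ν` it
cannot tell whether to be close to `0` at every `z_k` or not. Each term of the rate comes from one
such `ν`.

* `n ^ (-1/2)`: a field that is constant in space and equals `-t` with probability `1 - 1 / (2 n)`
  hides the constant mean `t` in all `n` curves with probability at least `1 / 2`. Centring the
  field forces a variance of order `n t²`, which allows `t` of order `n ^ (-1/2)`.
* `p_min ^ (-α)`: a bump of width `1 / (p_k + 1)` and height of order `p_k ^ (-α)` fits between the
  design hyperplanes orthogonal to the direction `k`, so it is not observed at all.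
* the logarithmic term: bumps of width `1 / N` and height of order `N ^ (-α)` on the cells of a
  regular partition are orthogonal on the design, and at least half of the `N ^ d` cells contain no
  more than twice the average share of its points. The uniform mixture over such cells has bounded
  `χ²` distance from the null law as long as the exponentiated energy of one bump does not exceed
  the number of cells.
-/

noncomputable section

namespace FDAMean

/-! ### Gaussian shifts -/

theorem lintegral_pi_prod {ι : Type*} [Fintype ι] {E : ι → Type*} [∀ i, MeasurableSpace (E i)]
    (μ : ∀ i, Measure (E i)) [∀ i, IsProbabilityMeasure (μ i)] {g : ∀ i, E i → ℝ≥0∞}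
    (hg : ∀ i, Measurable (g i)) :
    ∫⁻ y, ∏ i, g i (y i) ∂Measure.pi μ = ∏ i, ∫⁻ t, g i t ∂μ i := by
  have hind : iIndepFun (fun i (y : ∀ i, E i) => g i (y i)) (Measure.pi μ) :=
    iIndepFun_pi (X := g) fun i => (hg i).aemeasurable
  rw [lintegral_prod_eq_prod_lintegral_of_indepFun Finset.univ _ hind
    fun i => (hg i).comp (measurable_pi_apply i)]
  exact Finset.prod_congr rfl fun i _ => (measurePreserving_eval μ i).lintegral_comp (hg i)

theorem pi_withDensity {ι : Type*} [Fintype ι] {E : ι → Type*} [∀ i, MeasurableSpace (E i)]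
    (μ : ∀ i, Measure (E i)) [∀ i, IsProbabilityMeasure (μ i)] {g : ∀ i, E i → ℝ≥0∞}
    (hg : ∀ i, Measurable (g i)) [∀ i, SigmaFinite ((μ i).withDensity (g i))] :
    Measure.pi (fun i => (μ i).withDensity (g i)) =
      (Measure.pi μ).withDensity fun y => ∏ i, g i (y i) := by
  refine Measure.pi_eq fun s hs => ?_
  have hprod : (Set.univ.pi s).indicator (fun y => ∏ i, g i (y i)) =
      fun y => ∏ i, (s i).indicator (g i) (y i) := by
    ext y
    by_cases hy : ∀ i, y i ∈ s i
    · rw [Set.indicator_of_mem (Set.mem_univ_pi.mpr hy)]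
      exact Finset.prod_congr rfl fun i _ => (Set.indicator_of_mem (hy i) _).symm
    · rw [Set.indicator_of_notMem (mt Set.mem_univ_pi.mp hy)]
      obtain ⟨i, hi⟩ := not_forall.mp hy
      exact (Finset.prod_eq_zero (Finset.mem_univ i) (Set.indicator_of_notMem hi _)).symm
  rw [withDensity_apply _ (MeasurableSet.univ_pi hs),
    ← lintegral_indicator (MeasurableSet.univ_pi hs), hprod,
    lintegral_pi_prod μ fun i => (hg i).indicator (hs i)]
  simp only [lintegral_indicator (hs _), withDensity_apply _ (hs _)]

/-- The likelihood ratio `dN(a, v) / dN(0, v)` at `y`. -/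
def gaussianRatio (v : ℝ≥0) (a y : ℝ) : ℝ≥0∞ :=
  ENNReal.ofReal (Real.exp ((a * y - a ^ 2 / 2) / v))

@[fun_prop]
theorem measurable_gaussianRatio (v : ℝ≥0) (a : ℝ) : Measurable (gaussianRatio v a) := by
  unfold gaussianRatio
  fun_prop

theorem gaussianReal_withDensity_gaussianRatio {v : ℝ≥0} (hv : v ≠ 0) (a : ℝ) :
    (gaussianReal 0 v).withDensity (gaussianRatio v a) = gaussianReal a v := by
  have hv' : (v : ℝ) ≠ 0 := by exact_mod_cast hv
  rw [gaussianReal_of_var_ne_zero _ hv, gaussianReal_of_var_ne_zero _ hv,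
    ← withDensity_mul _ (measurable_gaussianPDF _ _) (measurable_gaussianRatio _ _)]
  congr 1
  ext y
  rw [Pi.mul_apply, gaussianPDF, gaussianPDF, gaussianRatio,
    ← ENNReal.ofReal_mul (gaussianPDFReal_nonneg _ _ _), gaussianPDFReal, gaussianPDFReal,
    mul_assoc, ← Real.exp_add]
  congr 3
  field_simp
  ring

theorem lintegral_gaussianRatio_mul {v : ℝ≥0} (hv : v ≠ 0) (a b : ℝ) :
    ∫⁻ y, gaussianRatio v a y * gaussianRatio v b y ∂gaussianReal 0 v =
      ENNReal.ofReal (Real.exp (a * b / v)) := by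
  have hv' : (v : ℝ) ≠ 0 := by exact_mod_cast hv
  have hsplit : ∀ y, gaussianRatio v a y * gaussianRatio v b y =
      ENNReal.ofReal (Real.exp (-(a ^ 2 + b ^ 2) / (2 * v))) *
        ENNReal.ofReal (Real.exp ((a + b) / v * y)) := by
    intro y
    rw [gaussianRatio, gaussianRatio, ← ENNReal.ofReal_mul (Real.exp_nonneg _),
      ← ENNReal.ofReal_mul (Real.exp_nonneg _), ← Real.exp_add, ← Real.exp_add]
    congr 2
    field_simp
    ring
  have hmgf := congrFun (mgf_id_gaussianReal (μ := 0) (v := v)) ((a + b) / v)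
  simp only [mgf, id] at hmgf
  simp_rw [hsplit]
  rw [lintegral_const_mul _ (by fun_prop),
    ← ofReal_integral_eq_lintegral_ofReal (integrable_exp_mul_gaussianReal _)
      (ae_of_all _ fun _ => Real.exp_nonneg _), hmgf,
    ← ENNReal.ofReal_mul (Real.exp_nonneg _), ← Real.exp_add]
  congr 2
  field_simp
  ring

section SignalLaw

variable {n : ℕ} {J : Type*} [Fintype J] {v : ℝ≥0}

/-- The law of `n` independent observations of the signal `θ` in Gaussian white noise of
variance `v`: the observations in the absence of the random fields. -/
def signalLaw (n : ℕ) (v : ℝ≥0) (θ : J → ℝ) : Measure (Fin n → J → ℝ) :=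
  Measure.pi fun _ => Measure.pi fun j => gaussianReal (θ j) v

instance (θ : J → ℝ) : IsProbabilityMeasure (signalLaw n v θ) := by
  unfold signalLaw
  infer_instance

theorem signalLaw_zero : signalLaw n v (0 : J → ℝ) =
    Measure.pi fun _ => Measure.pi fun _ => gaussianReal 0 v := rfl

/-- The likelihood ratio of the signal `θ` with respect to the signal `0`. -/
def signalRatio (v : ℝ≥0) (θ : J → ℝ) (y : Fin n → J → ℝ) : ℝ≥0∞ :=
  ∏ i, ∏ j, gaussianRatio v (θ j) (y i j)

theorem measurable_signalRatio (θ : J → ℝ) : Measurable (signalRatio (n := n) v θ) := by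
  unfold signalRatio
  fun_prop

theorem signalLaw_zero_withDensity_signalRatio (hv : v ≠ 0) (θ : J → ℝ) :
    (signalLaw n v (0 : J → ℝ)).withDensity (signalRatio v θ) = signalLaw n v θ := by
  have hrow : (Measure.pi fun _ : J => gaussianReal 0 v).withDensity
      (fun y => ∏ j, gaussianRatio v (θ j) (y j)) = Measure.pi fun j => gaussianReal (θ j) v := by
    have (j : J) : SigmaFinite ((gaussianReal 0 v).withDensity (gaussianRatio v (θ j))) := by
      rw [gaussianReal_withDensity_gaussianRatio hv]
      infer_instance
    rw [← pi_withDensity _ fun j => measurable_gaussianRatio v (θ j)]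
    simp only [gaussianReal_withDensity_gaussianRatio hv]
  have hσ : SigmaFinite ((Measure.pi fun _ : J => gaussianReal 0 v).withDensity
      fun y => ∏ j, gaussianRatio v (θ j) (y j)) := by
    rw [hrow]
    infer_instance
  rw [signalLaw_zero, signalLaw, ← hrow, pi_withDensity _ fun _ => by fun_prop]
  rfl

theorem lintegral_signalRatio (hv : v ≠ 0) (θ : J → ℝ) :
    ∫⁻ y, signalRatio v θ y ∂signalLaw n v (0 : J → ℝ) = 1 := by
  rw [← setLIntegral_univ, ← withDensity_apply _ MeasurableSet.univ,
    signalLaw_zero_withDensity_signalRatio hv, measure_univ]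

theorem lintegral_signalRatio_mul (hv : v ≠ 0) (θ η : J → ℝ) :
    ∫⁻ y, signalRatio v θ y * signalRatio v η y ∂signalLaw n v (0 : J → ℝ) =
      ENNReal.ofReal (Real.exp (n * (∑ j, θ j * η j) / v)) := by
  simp_rw [signalRatio, ← Finset.prod_mul_distrib]
  rw [signalLaw_zero, lintegral_pi_prod (fun _ : Fin n => Measure.pi fun _ : J => gaussianReal 0 v)
    (g := fun _ y => ∏ j, (gaussianRatio v (θ j) (y j) * gaussianRatio v (η j) (y j)))
    fun _ => by fun_prop]
  simp_rw [lintegral_pi_prod (fun _ : J => gaussianReal 0 v)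
    (g := fun j t => gaussianRatio v (θ j) t * gaussianRatio v (η j) t) fun _ => by fun_prop,
    lintegral_gaussianRatio_mul hv]
  rw [Finset.prod_const, Finset.card_univ, Fintype.card_fin,
    ← ENNReal.ofReal_prod_of_nonneg fun _ _ => Real.exp_nonneg _, ← Real.exp_sum,
    ← ENNReal.ofReal_pow (Real.exp_nonneg _), ← Real.exp_nat_mul, ← Finset.sum_div, mul_div_assoc]

end SignalLaw

/-! ### Laws with a common part -/

section CommonPart

variable {Y : Type*} [MeasurableSpace Y]

theorem le_of_common_part {P Q ν : Measure Y} (hP : ν ≤ P) (hQ : ν ≤ Q) {e₀ e₁ : Y → ℝ≥0∞}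
    (he : Measurable e₀) {δ R : ℝ≥0∞} (hδ : ∀ y, δ ≤ e₀ y + e₁ y) (h0 : ∫⁻ y, e₀ y ∂P ≤ R)
    (h1 : ∫⁻ y, e₁ y ∂Q ≤ R) : δ * ν Set.univ ≤ 2 * R := by
  calc δ * ν Set.univ = ∫⁻ _, δ ∂ν := (lintegral_const δ).symm
    _ ≤ ∫⁻ y, (e₀ y + e₁ y) ∂ν := lintegral_mono hδ
    _ = ∫⁻ y, e₀ y ∂ν + ∫⁻ y, e₁ y ∂ν := lintegral_add_left he _
    _ ≤ R + R := add_le_add ((lintegral_mono' hP le_rfl).trans h0)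
        ((lintegral_mono' hQ le_rfl).trans h1)
    _ = 2 * R := (two_mul R).symm

theorem le_min_one_add_sq_div_four (l : ℝ≥0∞) : l ≤ min 1 l + l * l / 4 := by
  rcases le_total l 1 with h | h
  · rw [min_eq_right h]
    exact le_self_add
  rcases eq_or_ne l ∞ with rfl | hl
  · simp [ENNReal.top_div]
  lift l to ℝ≥0 using hl
  rw [min_eq_left h, show (4 : ℝ≥0∞) = ((4 : ℝ≥0) : ℝ≥0∞) by norm_num, ← ENNReal.coe_mul,
    ← ENNReal.coe_div (by norm_num), ← ENNReal.coe_one, ← ENNReal.coe_add, ENNReal.coe_le_coe,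
    ← NNReal.coe_le_coe]
  push_cast
  nlinarith [sq_nonneg ((l : ℝ) - 2)]

theorem half_le_lintegral_min_one {P : Measure Y} {g : Y → ℝ≥0∞} (hg : Measurable g)
    (h1 : ∫⁻ y, g y ∂P = 1) (h2 : ∫⁻ y, g y * g y ∂P ≤ 2) : 2⁻¹ ≤ ∫⁻ y, min 1 (g y) ∂P := by
  have h24 : (2 : ℝ≥0∞) / 4 = 2⁻¹ :=
    (ENNReal.toReal_eq_toReal_iff' (by finiteness) (by finiteness)).mp (by norm_num)
  have key : (1 : ℝ≥0∞) ≤ ∫⁻ y, min 1 (g y) ∂P + 2⁻¹ := by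
    calc (1 : ℝ≥0∞) = ∫⁻ y, g y ∂P := h1.symm
      _ ≤ ∫⁻ y, (min 1 (g y) + g y * g y / 4) ∂P :=
          lintegral_mono fun y => le_min_one_add_sq_div_four _
      _ = ∫⁻ y, min 1 (g y) ∂P + (∫⁻ y, g y * g y ∂P) / 4 := by
          rw [lintegral_add_left (by fun_prop)]
          simp only [div_eq_mul_inv]
          rw [lintegral_mul_const _ (by fun_prop)]
      _ ≤ ∫⁻ y, min 1 (g y) ∂P + 2⁻¹ := by
          rw [← h24]
          gcongr
  rw [← ENNReal.one_sub_inv_two]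
  exact tsub_le_iff_right.mpr key

variable {ι : Type*} [Fintype ι] {P : Measure Y} {w : ι → ℝ≥0∞} {ℓ : ι → Y → ℝ≥0∞}

theorem lintegral_mixture_mul_self_le_two (hm : ∀ k, Measurable (ℓ k)) (hw : ∑ k, w k = 1)
    (hoff : ∀ k l, k ≠ l → ∫⁻ y, ℓ k y * ℓ l y ∂P ≤ 1)
    (hdiag : ∀ k, w k * ∫⁻ y, ℓ k y * ℓ k y ∂P ≤ 1) :
    ∫⁻ y, (∑ k, w k * ℓ k y) * ∑ k, w k * ℓ k y ∂P ≤ 2 := by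
  classical
  have hexpand : ∫⁻ y, (∑ k, w k * ℓ k y) * ∑ k, w k * ℓ k y ∂P =
      ∑ k, ∑ l, w k * (w l * ∫⁻ y, ℓ k y * ℓ l y ∂P) := by
    simp_rw [Finset.sum_mul_sum, mul_mul_mul_comm, mul_assoc]
    rw [lintegral_finsetSum _ fun k _ => by fun_prop]
    refine Finset.sum_congr rfl fun k _ => ?_
    rw [lintegral_finsetSum _ fun l _ => by fun_prop]
    refine Finset.sum_congr rfl fun l _ => ?_
    rw [lintegral_const_mul _ (by fun_prop), lintegral_const_mul _ (by fun_prop)]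
  have hterm (k l : ι) : w k * (w l * ∫⁻ y, ℓ k y * ℓ l y ∂P) ≤
      (if k = l then w k else 0) + w k * w l := by
    rcases eq_or_ne k l with rfl | hkl
    · rw [if_pos rfl]
      exact (mul_le_of_le_one_right' (hdiag k)).trans le_self_add
    · rw [if_neg hkl, zero_add]
      gcongr
      exact mul_le_of_le_one_right' (hoff k l hkl)
  calc _ ≤ ∑ k, ∑ l, ((if k = l then w k else 0) + w k * w l) :=
        hexpand.trans_le (Finset.sum_le_sum fun k _ => Finset.sum_le_sum fun l _ => hterm k l)
    _ = ∑ k, w k + (∑ k, w k) * ∑ k, w k := by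
        simp [Finset.sum_add_distrib, Finset.sum_mul_sum]
    _ = 2 := by rw [hw]; norm_num

theorem withDensity_mixture (hm : ∀ k, Measurable (ℓ k)) :
    P.withDensity (fun y => ∑ k, w k * ℓ k y) = ∑ k, w k • P.withDensity (ℓ k) := by
  ext s hs
  simp only [withDensity_apply _ hs, Measure.finsetSum_apply, Measure.smul_apply, smul_eq_mul]
  rw [lintegral_finsetSum _ fun k _ => by fun_prop]
  exact Finset.sum_congr rfl fun k _ => lintegral_const_mul _ (hm k)

theorem exists_common_part_mixture (hm : ∀ k, Measurable (ℓ k)) (hw : ∑ k, w k = 1)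
    (h1 : ∀ k, ∫⁻ y, ℓ k y ∂P = 1) (hoff : ∀ k l, k ≠ l → ∫⁻ y, ℓ k y * ℓ l y ∂P ≤ 1)
    (hdiag : ∀ k, w k * ∫⁻ y, ℓ k y * ℓ k y ∂P ≤ 1) :
    ∃ ν ≤ P, ν ≤ ∑ k, w k • P.withDensity (ℓ k) ∧ 2⁻¹ ≤ ν Set.univ := by
  have hmean : ∫⁻ y, ∑ k, w k * ℓ k y ∂P = 1 := by
    rw [lintegral_finsetSum _ fun k _ => by fun_prop]
    simp_rw [lintegral_const_mul _ (hm _), h1, mul_one, hw]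
  refine ⟨P.withDensity fun y => min 1 (∑ k, w k * ℓ k y), ?_, ?_, ?_⟩
  · exact (withDensity_mono (ae_of_all _ fun y => min_le_left _ _)).trans_eq withDensity_one
  · exact (withDensity_mono (ae_of_all _ fun y => min_le_right _ _)).trans_eq
      (withDensity_mixture hm)
  · rw [withDensity_apply _ MeasurableSet.univ, setLIntegral_univ]
    exact half_le_lintegral_min_one (by fun_prop) hmean
      (lintegral_mixture_mul_self_le_two hm hw hoff hdiag)

end CommonPart

/-! ### Product functions in Hölder classes -/

section Holder

open scoped ContDiff

variable {d : ℕ}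

/-- `c ∏ₖ gₖ^{(bₖ)}(xₖ)`: the partial derivative of order `b` of the product function
`c ∏ₖ gₖ(xₖ)`, which is the case `b = 0`. -/
def separable (c : ℝ) (g : Fin d → ℝ → ℝ) (b : Fin d → ℕ) (x : Fin d → ℝ) : ℝ :=
  c * ∏ k, iteratedDeriv (b k) (g k) (x k)

theorem separable_update (c : ℝ) (g : Fin d → ℝ → ℝ) (b : Fin d → ℕ) (x : Fin d → ℝ) (k : Fin d)
    (t : ℝ) : separable c g b (Function.update x k t) =
      c * (∏ i ∈ Finset.univ.erase k, iteratedDeriv (b i) (g i) (x i)) *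
        iteratedDeriv (b k) (g k) t := by
  rw [separable, ← Finset.prod_erase_mul _ _ (Finset.mem_univ k), Function.update_self, mul_assoc]
  congr 2
  exact Finset.prod_congr rfl fun i hi => by rw [Function.update_of_ne (Finset.ne_of_mem_erase hi)]

theorem separable_add_single (c : ℝ) (g : Fin d → ℝ → ℝ) (b : Fin d → ℕ) (x : Fin d → ℝ)
    (k : Fin d) : separable c g (b + Pi.single k 1) x =
      c * (∏ i ∈ Finset.univ.erase k, iteratedDeriv (b i) (g i) (x i)) *
        iteratedDeriv (b k + 1) (g k) (x k) := by
  rw [separable, ← Finset.prod_erase_mul _ _ (Finset.mem_univ k), Pi.add_apply, Pi.single_eq_same,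
    mul_assoc]
  congr 2
  refine Finset.prod_congr rfl fun i hi => ?_
  rw [Pi.add_apply, Pi.single_eq_of_ne (Finset.ne_of_mem_erase hi), add_zero]

theorem update_mem_cube {x : Fin d → ℝ} (hx : x ∈ cube d) (k : Fin d) {t : ℝ}
    (ht : t ∈ Set.Icc (0 : ℝ) 1) : Function.update x k t ∈ cube d :=
  ⟨le_update_iff.mpr ⟨ht.1, fun i _ => hx.1 i⟩, update_le_iff.mpr ⟨ht.2, fun i _ => hx.2 i⟩⟩

variable {c : ℝ} {g : Fin d → ℝ → ℝ} {F : (Fin d → ℝ) → ℝ} {b : Fin d → ℕ}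

theorem hasDerivAt_iteratedDeriv {f : ℝ → ℝ} (hf : ContDiff ℝ ∞ f) (j : ℕ) (t : ℝ) :
    HasDerivAt (iteratedDeriv j f) (iteratedDeriv (j + 1) f t) t := by
  rw [iteratedDeriv_succ]
  exact (hf.differentiable_iteratedDeriv j (by exact_mod_cast ENat.natCast_lt_top j) t).hasDerivAt

theorem hasDerivWithinAt_of_eqOn_separable (hg : ∀ k, ContDiff ℝ ∞ (g k))
    (hF : Set.EqOn F (separable c g b) (cube d)) (k : Fin d) {x : Fin d → ℝ} (hx : x ∈ cube d) :
    HasDerivWithinAt (fun t : ℝ => F (Function.update x k t))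
      (separable c g (b + Pi.single k 1) x) (Set.Icc 0 1) (x k) := by
  have hsplit : ∀ t ∈ Set.Icc (0 : ℝ) 1, F (Function.update x k t) =
      c * (∏ i ∈ Finset.univ.erase k, iteratedDeriv (b i) (g i) (x i)) *
        iteratedDeriv (b k) (g k) t := fun t ht => by
    rw [hF (update_mem_cube hx k ht), separable_update]
  rw [separable_add_single]
  exact (((hasDerivAt_iteratedDeriv (hg k) (b k) (x k)).const_mul _).hasDerivWithinAt).congr hsplit
    (hsplit (x k) ⟨hx.1 k, hx.2 k⟩)

theorem hasPartialDeriv_of_eqOn_separable (hg : ∀ k, ContDiff ℝ ∞ (g k))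
    (hF : Set.EqOn F (separable c g b) (cube d)) (k : Fin d) : HasPartialDeriv k F :=
  fun _ hx => (hasDerivWithinAt_of_eqOn_separable hg hF k hx).differentiableWithinAt

theorem partialDeriv_iterate_eqOn_separable (hg : ∀ k, ContDiff ℝ ∞ (g k))
    (hF : Set.EqOn F (separable c g b) (cube d)) (k : Fin d) (m : ℕ) :
    Set.EqOn ((partialDeriv k)^[m] F) (separable c g (b + Pi.single k m)) (cube d) := by
  induction m with
  | zero => simpa only [Function.iterate_zero, id_eq, Pi.single_zero, add_zero] using hF
  | succ m ih =>
    intro x hx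
    rw [Function.iterate_succ_apply', Pi.single_add, ← add_assoc]
    exact (hasDerivWithinAt_of_eqOn_separable hg ih k hx).derivWithin
      (uniqueDiffOn_Icc_zero_one _ ⟨hx.1 k, hx.2 k⟩)

theorem multiDeriv_separable (hg : ∀ k, ContDiff ℝ ∞ (g k)) (b : Fin d → ℕ) :
    Set.EqOn (multiDeriv b (separable c g 0)) (separable c g b) (cube d) := by
  have hlist : ∀ l : List (Fin d), Set.EqOn
      (l.foldr (fun k F => (partialDeriv k)^[b k] F) (separable c g 0))
      (separable c g ((l.map fun k => Pi.single k (b k)).sum)) (cube d) := by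
    intro l
    induction l with
    | nil => exact Set.eqOn_refl _ _
    | cons k l ih =>
      rw [List.map_cons, List.sum_cons, add_comm]
      exact partialDeriv_iterate_eqOn_separable hg ih k (b k)
  have h := hlist (List.finRange d)
  rwa [← Fin.sum_univ_def, Finset.univ_sum_single] at h

theorem abs_prod_sub_prod_le {ι : Type*} (s : Finset ι) {u w B : ι → ℝ} {ε : ℝ}
    (hu : ∀ i, |u i| ≤ B i) (hw : ∀ i, |w i| ≤ B i) (huw : ∀ i, |u i - w i| ≤ B i * ε) :
    |∏ i ∈ s, u i - ∏ i ∈ s, w i| ≤ (∏ i ∈ s, B i) * (s.card * ε) := by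
  classical
  induction s using Finset.induction_on with
  | empty => simp
  | insert i s hi ih =>
    rw [Finset.prod_insert hi, Finset.prod_insert hi, Finset.prod_insert hi,
      Finset.card_insert_of_notMem hi]
    have hsplit : u i * ∏ j ∈ s, u j - w i * ∏ j ∈ s, w j =
        u i * (∏ j ∈ s, u j - ∏ j ∈ s, w j) + (u i - w i) * ∏ j ∈ s, w j := by ring
    have hws : |∏ j ∈ s, w j| ≤ ∏ j ∈ s, B j := by
      rw [Finset.abs_prod]
      exact Finset.prod_le_prod (fun _ _ => abs_nonneg _) fun j _ => hw j
    calc _ ≤ |u i| * |∏ j ∈ s, u j - ∏ j ∈ s, w j| + |u i - w i| * |∏ j ∈ s, w j| := by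
          rw [hsplit, ← abs_mul, ← abs_mul]
          exact abs_add_le _ _
      _ ≤ B i * ((∏ j ∈ s, B j) * (s.card * ε)) + B i * ε * ∏ j ∈ s, B j :=
          add_le_add (mul_le_mul (hu i) ih (abs_nonneg _) ((abs_nonneg _).trans (hu i)))
            (mul_le_mul (huw i) hws (abs_nonneg _) ((abs_nonneg _).trans (huw i)))
      _ = _ := by push_cast; ring

theorem prod_mul_pow_eq (A s : ℝ) (b : Fin d → ℕ) :
    ∏ k, A * s ^ b k = A ^ d * s ^ ∑ k, b k := by
  rw [Finset.prod_mul_distrib, Finset.prod_const, Finset.card_univ, Fintype.card_fin,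
    Finset.prod_pow_eq_pow_sum]

variable {A s : ℝ}

theorem abs_separable_le
    (hbd : ∀ k, ∀ j ≤ ∑ i, b i, ∀ t, |iteratedDeriv j (g k) t| ≤ A * s ^ j) (x : Fin d → ℝ) :
    |separable c g b x| ≤ |c| * (A ^ d * s ^ ∑ i, b i) := by
  rw [separable, abs_mul, Finset.abs_prod, ← prod_mul_pow_eq]
  exact mul_le_mul_of_nonneg_left (Finset.prod_le_prod (fun _ _ => abs_nonneg _) fun k _ =>
    hbd k _ (Finset.single_le_sum_of_canonicallyOrdered (Finset.mem_univ k)) _) (abs_nonneg c)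

theorem abs_separable_sub_le (hg : ∀ k, ContDiff ℝ ∞ (g k))
    (hbd : ∀ k, ∀ j ≤ ∑ i, b i + 1, ∀ t, |iteratedDeriv j (g k) t| ≤ A * s ^ j)
    (x y : Fin d → ℝ) : |separable c g b x - separable c g b y| ≤
      |c| * (A ^ d * s ^ ∑ i, b i) * (d * (s * ‖x - y‖)) := by
  have hb (k : Fin d) : b k ≤ ∑ i, b i :=
    Finset.single_le_sum_of_canonicallyOrdered (Finset.mem_univ k)
  have hval (k : Fin d) (t : ℝ) : |iteratedDeriv (b k) (g k) t| ≤ A * s ^ b k :=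
    hbd k _ ((hb k).trans (Nat.le_succ _)) t
  have hder (k : Fin d) (t : ℝ) : ‖iteratedDeriv (b k + 1) (g k) t‖ ≤ A * s ^ (b k + 1) :=
    hbd k _ (Nat.succ_le_succ (hb k)) t
  have hlip (k : Fin d) : |iteratedDeriv (b k) (g k) (x k) - iteratedDeriv (b k) (g k) (y k)| ≤
      A * s ^ b k * (s * ‖x - y‖) := by
    calc _ ≤ A * s ^ (b k + 1) * |x k - y k| :=
          convex_univ.norm_image_sub_le_of_norm_hasDerivWithin_le
            (fun t _ => (hasDerivAt_iteratedDeriv (hg k) (b k) t).hasDerivWithinAt)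
            (fun t _ => hder k t) trivial trivial
      _ ≤ A * s ^ (b k + 1) * ‖x - y‖ :=
          mul_le_mul_of_nonneg_left (norm_le_pi_norm (x - y) k) ((norm_nonneg _).trans (hder k 0))
      _ = _ := by ring
  rw [separable, separable, ← mul_sub, abs_mul, mul_assoc, ← prod_mul_pow_eq]
  refine mul_le_mul_of_nonneg_left ?_ (abs_nonneg c)
  simpa only [Finset.card_univ, Fintype.card_fin] using
    abs_prod_sub_prod_le Finset.univ (fun k => hval k (x k)) (fun k => hval k (y k)) hlip

theorem strictFloor_lt {α : ℝ} (hα : 0 < α) : (strictFloor α : ℝ) < α :=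
  (strictFloor_isGreatest hα).1

theorem sub_strictFloor_le_one {α : ℝ} (hα : 0 < α) : α - strictFloor α ≤ 1 := by
  by_contra! h
  have hlt : ((strictFloor α + 1 : ℕ) : ℝ) < α := by
    push_cast
    linarith
  exact Nat.not_succ_le_self _ ((strictFloor_isGreatest hα).2 hlt)

theorem holderNorm_le {α K₁ K₂ : ℝ} (hK₁ : 0 ≤ K₁) (hK₂ : 0 ≤ K₂)
    (hF : ∀ b : Fin d → ℕ, ∑ k, b k ≤ strictFloor α → ∀ x ∈ cube d, |multiDeriv b F x| ≤ K₁)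
    (hF' : ∀ b : Fin d → ℕ, ∑ k, b k = strictFloor α → ∀ x ∈ cube d, ∀ y ∈ cube d,
      |multiDeriv b F x - multiDeriv b F y| ≤ K₂ * ‖x - y‖ ^ (α - strictFloor α)) :
    holderNorm α F ≤ ENNReal.ofReal (K₁ + K₂) := by
  rw [ENNReal.ofReal_add hK₁ hK₂]
  refine add_le_add (iSup₂_le fun b hb => iSup₂_le fun x hx => ?_)
    (iSup₂_le fun b hb => iSup₂_le fun x hx => iSup₂_le fun y hy => iSup_le fun _ => ?_)
  · rw [Real.enorm_eq_ofReal_abs]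
    exact ENNReal.ofReal_le_ofReal (hF b hb x hx)
  · rw [Real.enorm_eq_ofReal_abs]
    refine ENNReal.div_le_of_le_mul ?_
    rw [← ENNReal.ofReal_mul hK₂]
    exact ENNReal.ofReal_le_ofReal (hF' b hb x hx y hy)

theorem le_mul_rpow_of_le_of_le_mul {u K K' ε r : ℝ} (hK : 0 ≤ K) (hK' : 0 ≤ K') (hε : 0 ≤ ε)
    (hr0 : 0 ≤ r) (hr1 : r ≤ 1) (hu : u ≤ K) (hu' : u ≤ K' * ε) : u ≤ (K + K') * ε ^ r := by
  have hpow : 0 ≤ ε ^ r := Real.rpow_nonneg hε r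
  rw [add_mul]
  rcases le_total ε 1 with h | h
  · have := mul_le_mul_of_nonneg_left (Real.self_le_rpow_of_le_one hε h hr1) hK'
    linarith [mul_nonneg hK hpow]
  · have := mul_le_mul_of_nonneg_left (Real.one_le_rpow h hr0) hK
    linarith [mul_nonneg hK' hpow]

theorem separable_mem_holderClass {α L : ℝ} (hα : 0 < α) (hg : ∀ k, ContDiff ℝ ∞ (g k))
    (hs : 1 ≤ s) (hA : 0 ≤ A)
    (hbd : ∀ k, ∀ j ≤ strictFloor α + 1, ∀ t, |iteratedDeriv j (g k) t| ≤ A * s ^ j)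
    (hc : 0 ≤ c) (hL : c * (A ^ d * (d + 3)) ≤ L) :
    separable (c * s ^ (-α)) g 0 ∈ holderClass d α L := by
  refine ⟨fun b _ k => hasPartialDeriv_of_eqOn_separable hg (multiDeriv_separable hg b) k, ?_⟩
  have hs0 : 0 < s := one_pos.trans_le hs
  have hcs : |c * s ^ (-α)| = c * s ^ (-α) := abs_of_nonneg (by positivity)
  have hsize (b : Fin d → ℕ) (hb : ∑ k, b k ≤ strictFloor α) (x : Fin d → ℝ) :
      |separable (c * s ^ (-α)) g b x| ≤ c * s ^ (-α) * (A ^ d * s ^ ∑ k, b k) :=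
    (abs_separable_le (fun k j hj => hbd k j (by lia)) x).trans_eq (by rw [hcs])
  refine (holderNorm_le (K₁ := c * A ^ d) (K₂ := c * A ^ d * (2 + d)) (by positivity)
    (by positivity) (fun b hb x hx => ?_) fun b hb x hx y hy => ?_).trans
    (ENNReal.ofReal_le_ofReal (by linarith))
  · have hscale : s ^ (-α) * s ^ ∑ k, b k ≤ 1 := by
      rw [← Real.rpow_natCast, ← Real.rpow_add hs0]
      have : ((∑ k, b k : ℕ) : ℝ) ≤ strictFloor α := by exact_mod_cast hb
      exact Real.rpow_le_one_of_one_le_of_nonpos hs (by linarith [strictFloor_lt hα])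
    rw [multiDeriv_separable hg b hx]
    calc _ ≤ c * A ^ d * (s ^ (-α) * s ^ ∑ k, b k) := (hsize b hb x).trans_eq (by ring)
      _ ≤ c * A ^ d := mul_le_of_le_one_right (by positivity) hscale
  · have hscale : s ^ (-α) * s ^ (∑ k, b k) * s ^ (α - strictFloor α) = 1 := by
      rw [hb, ← Real.rpow_natCast, ← Real.rpow_add hs0, ← Real.rpow_add hs0]
      simp
    have hbdd := abs_sub (separable (c * s ^ (-α)) g b x) (separable (c * s ^ (-α)) g b y)
    have hlip := abs_separable_sub_le (c := c * s ^ (-α)) (b := b) (A := A) (s := s) hg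
      (fun k j hj => hbd k j (by lia)) x y
    rw [hcs] at hlip
    rw [multiDeriv_separable hg b hx, multiDeriv_separable hg b hy]
    set K := c * s ^ (-α) * (A ^ d * s ^ ∑ k, b k)
    have hK : 0 ≤ K := by positivity
    calc _ ≤ (2 * K + K * d) * (s * ‖x - y‖) ^ (α - strictFloor α) :=
          le_mul_rpow_of_le_of_le_mul (mul_nonneg zero_le_two hK)
            (mul_nonneg hK d.cast_nonneg) (by positivity)
            (sub_nonneg.mpr (strictFloor_lt hα).le) (sub_strictFloor_le_one hα)
            (by linarith [hsize b hb.le x, hsize b hb.le y]) (hlip.trans_eq (by ring))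
      _ = c * A ^ d * (2 + d) * ‖x - y‖ ^ (α - strictFloor α) *
            (s ^ (-α) * s ^ (∑ k, b k) * s ^ (α - strictFloor α)) := by
          simp only [K, Real.mul_rpow hs0.le (norm_nonneg _)]
          ring
      _ = _ := by rw [hscale, mul_one]

theorem const_mem_holderClass {α L : ℝ} (hα : 0 < α) (hc : 0 ≤ c) (hL : c * (d + 3) ≤ L) :
    (fun _ : Fin d → ℝ => c) ∈ holderClass d α L := by
  have h := separable_mem_holderClass (d := d) (A := 1) (s := 1) (g := fun _ _ => 1) hα
    (fun _ => contDiff_const) le_rfl zero_le_one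
    (fun _ j _ t => by rw [iteratedDeriv_const]; split_ifs <;> simp) hc (by simpa using hL)
  have heq : separable (d := d) (c * 1 ^ (-α)) (fun _ _ => 1) 0 = fun _ => c := by
    ext x
    simp [separable]
  rwa [heq] at h

theorem zero_mem_holderClass {α L : ℝ} (hα : 0 < α) (hL : 0 ≤ L) :
    (0 : (Fin d → ℝ) → ℝ) ∈ holderClass d α L :=
  const_mem_holderClass hα (c := 0) le_rfl (by rwa [zero_mul])

end Holder

/-! ### Localised bumps -/

section Bump

open scoped ContDiff

variable {d : ℕ}

/-- A smooth bump supported in `[0, 1]` with peak value `1` at `1 / 2`. -/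
def unitBump : ContDiffBump (1 / 2 : ℝ) := ⟨1 / 4, 1 / 2, by norm_num, by norm_num⟩

theorem exists_unitBump_deriv_bound (m : ℕ) :
    ∃ A : ℝ, 0 < A ∧ ∀ j ≤ m, ∀ t, |iteratedDeriv j unitBump t| ≤ A := by
  have hcpt (j : ℕ) : HasCompactSupport (iteratedDeriv j unitBump) := by
    induction j with
    | zero => simpa only [iteratedDeriv_zero] using unitBump.hasCompactSupport
    | succ j ih => simpa only [iteratedDeriv_succ] using ih.deriv
  choose B hB using fun j => (hcpt j).exists_bound_of_continuous
    ((unitBump.contDiff (n := j)).continuous_iteratedDeriv j le_rfl)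
  have hB0 (j : ℕ) : 0 ≤ B j := (norm_nonneg _).trans (hB j 0)
  refine ⟨1 + ∑ j ∈ Finset.range (m + 1), B j,
    add_pos_of_pos_of_nonneg one_pos (Finset.sum_nonneg fun j _ => hB0 j), fun j hj t => ?_⟩
  calc |iteratedDeriv j unitBump t| ≤ B j := hB j t
    _ ≤ ∑ j ∈ Finset.range (m + 1), B j := Finset.single_le_sum (fun j _ => hB0 j)
        (Finset.mem_range.mpr (Nat.lt_succ_of_le hj))
    _ ≤ _ := le_add_of_nonneg_left zero_le_one

/-- The smooth bump supported in the cell `∏ₖ [qₖ / N, (qₖ + 1) / N]` of the regular partition of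
the cube into `N ^ d` cells. -/
def cellBump (N : ℕ) (q : Fin d → Fin N) (x : Fin d → ℝ) : ℝ :=
  ∏ k, unitBump (N * x k - (q k : ℕ))

/-- The centre of the cell `q` of the partition of the cube into `N ^ d` cells. -/
def cellCenter (N : ℕ) (q : Fin d → Fin N) (k : Fin d) : ℝ :=
  ((q k : ℕ) + 1 / 2) / N

variable {N : ℕ} {q q' : Fin d → Fin N}

theorem cellCenter_mem_cube (q : Fin d → Fin N) : cellCenter N q ∈ cube d := by
  have hle (k : Fin d) : cellCenter N q k ≤ 1 := by
    refine div_le_one_of_le₀ ?_ N.cast_nonneg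
    have : (((q k : ℕ) + 1 : ℕ) : ℝ) ≤ N := by exact_mod_cast (q k).isLt
    push_cast at this
    linarith
  exact ⟨fun k => div_nonneg (by positivity) N.cast_nonneg, hle⟩

theorem cellBump_cellCenter (hN : 0 < N) (q : Fin d → Fin N) :
    cellBump N q (cellCenter N q) = 1 := by
  have hN' : (N : ℝ) ≠ 0 := by exact_mod_cast hN.ne'
  refine Finset.prod_eq_one fun k _ => ?_
  rw [cellCenter, mul_div_cancel₀ _ hN', add_sub_cancel_left]
  exact unitBump.one_of_mem_closedBall (Metric.mem_closedBall_self unitBump.rIn_pos.le)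

theorem cellBump_nonneg (N : ℕ) (q : Fin d → Fin N) (x : Fin d → ℝ) : 0 ≤ cellBump N q x :=
  Finset.prod_nonneg fun _ _ => unitBump.nonneg

theorem cellBump_le_one (N : ℕ) (q : Fin d → Fin N) (x : Fin d → ℝ) : cellBump N q x ≤ 1 :=
  Finset.prod_le_one (fun _ _ => unitBump.nonneg) fun _ _ => unitBump.le_one

theorem cellBump_eq_zero {x : Fin d → ℝ} (k : Fin d)
    (hk : N * x k ∉ Set.Ioo ((q k : ℕ) : ℝ) ((q k : ℕ) + 1)) : cellBump N q x = 0 := by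
  refine Finset.prod_eq_zero (Finset.mem_univ k) (unitBump.zero_of_le_dist ?_)
  change (1 / 2 : ℝ) ≤ dist _ _
  by_contra! h
  rw [Real.dist_eq, abs_lt] at h
  exact hk ⟨by linarith, by linarith⟩

theorem natCast_eq_of_mem_Ioo {a b : ℕ} {t : ℝ} (ha : t ∈ Set.Ioo (a : ℝ) (a + 1))
    (hb : t ∈ Set.Ioo (b : ℝ) (b + 1)) : a = b := by
  have hab : a < b + 1 := by exact_mod_cast ha.1.trans hb.2
  have hba : b < a + 1 := by exact_mod_cast hb.1.trans ha.2
  lia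

theorem cellBump_mul_cellBump_of_ne (h : q ≠ q') (x : Fin d → ℝ) :
    cellBump N q x * cellBump N q' x = 0 := by
  obtain ⟨k, hk⟩ := Function.ne_iff.mp h
  by_contra! hne
  have hq := not_imp_comm.mp (cellBump_eq_zero k) (left_ne_zero_of_mul hne)
  have hq' := not_imp_comm.mp (cellBump_eq_zero k) (right_ne_zero_of_mul hne)
  exact hk (Fin.ext (natCast_eq_of_mem_Ioo hq hq'))

theorem sum_cellBump_sq_le_one (N : ℕ) (x : Fin d → ℝ) :
    ∑ q : Fin d → Fin N, cellBump N q x ^ 2 ≤ 1 := by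
  by_cases h : ∃ q : Fin d → Fin N, cellBump N q x ≠ 0
  · obtain ⟨q, hq⟩ := h
    have hother (q' : Fin d → Fin N) (hne : q' ≠ q) : cellBump N q' x ^ 2 = 0 := by
      rw [(mul_eq_zero_iff_right hq).mp (cellBump_mul_cellBump_of_ne hne x), zero_pow two_ne_zero]
    rw [Fintype.sum_eq_single q hother]
    exact pow_le_one₀ (cellBump_nonneg N q x) (cellBump_le_one N q x)
  · push Not at h
    simp [h]

theorem exists_cellBump_mem_holderClass {α L : ℝ} (hα : 0 < α) (hL : 0 < L) :
    ∃ c₀ : ℝ, 0 < c₀ ∧ ∀ c, 0 ≤ c → c ≤ c₀ → ∀ N : ℕ, 0 < N → ∀ q : Fin d → Fin N,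
      (fun x => c * (N : ℝ) ^ (-α) * cellBump N q x) ∈ holderClass d α L := by
  obtain ⟨A, hA, hbd⟩ := exists_unitBump_deriv_bound (strictFloor α + 1)
  have hK : 0 < A ^ d * (d + 3) := by positivity
  refine ⟨L / (A ^ d * (d + 3)), by positivity, fun c hc hcc N hN q => ?_⟩
  have hsmooth (a : ℝ) : ContDiff ℝ ∞ fun t => unitBump (t - a) :=
    unitBump.contDiff.comp (contDiff_id.sub contDiff_const)
  have hderiv (k : Fin d) (j : ℕ) (hj : j ≤ strictFloor α + 1) (t : ℝ) :
      |iteratedDeriv j (fun t => unitBump (N * t - (q k : ℕ))) t| ≤ A * (N : ℝ) ^ j := by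
    rw [iteratedDeriv_comp_const_mul ((hsmooth (q k : ℕ)).of_le (by exact_mod_cast le_top))
      (N : ℝ), iteratedDeriv_comp_sub_const, abs_mul, abs_of_nonneg (by positivity), mul_comm]
    exact mul_le_mul_of_nonneg_right (hbd j hj _) (by positivity)
  have h := separable_mem_holderClass hα
    (fun k => (hsmooth (q k : ℕ)).comp (contDiff_const.mul contDiff_id))
    (by exact_mod_cast hN) hA.le hderiv hc ((le_div_iff₀ hK).mp hcc)
  convert h using 2 with x
  simp [cellBump, separable]

end Bump

/-! ### Spatially constant random fields -/

/-- The random field that is constant in space, with value distributed according to `ν`. -/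
def constField (d : ℕ) (ν : Measure ℝ) [IsProbabilityMeasure ν] : RandomField d where
  Ω := ℝ
  P := ν
  Z _ ω := ω
  meas _ _ := measurable_id

theorem constField_mem_processClass {d : ℕ} {β₀ C : ℝ} (hβ : β₀ ≤ 1) (hC : 0 < C)
    {ν : Measure ℝ} [IsProbabilityMeasure ν] (hν : MemLp id 2 ν) (hmean : ∫ ω, ω ∂ν = 0)
    (hsq : ∫ ω, ω ^ 2 ∂ν ≤ C / 2) : constField d ν ∈ processClass d β₀ C := by
  refine ⟨fun x _ => ⟨hν, hmean⟩, 1, ⟨hβ, le_rfl⟩, fun _ => √(C / 2), measurable_const,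
    fun _ => Real.sqrt_pos.mpr (half_pos hC), memLp_const _, ?_,
    ae_of_all _ fun (ω : ℝ) x _ y _ => ?_⟩
  · rw [integral_const, probReal_univ, one_smul, Real.sq_sqrt (half_pos hC).le]
    exact (add_le_add_right hsq _).trans_eq (add_halves C)
  · change |ω - ω| ≤ √(C / 2) * ‖x - y‖ ^ (1 : ℝ)
    rw [sub_self, abs_zero]
    positivity

theorem constField_dirac_zero_mem_processClass {d : ℕ} {β₀ C : ℝ} (hβ : β₀ ≤ 1) (hC : 0 < C) :
    constField d (Measure.dirac 0) ∈ processClass d β₀ C :=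
  constField_mem_processClass hβ hC ((memLp_two_iff_integrable_sq
    measurable_id.aestronglyMeasurable).mpr (integrable_dirac enorm_lt_top))
    (integral_dirac _ _) (by simpa using (half_pos hC).le)

theorem exists_centered_law_atom {q : ℝ} (hq0 : 0 < q) (hq1 : q ≤ 1) (t : ℝ) :
    ∃ ν : Measure ℝ, IsProbabilityMeasure ν ∧ MemLp id 2 ν ∧ ∫ ω, ω ∂ν = 0 ∧
      ∫ ω, ω ^ 2 ∂ν ≤ t ^ 2 / q ∧ ENNReal.ofReal (1 - q) ≤ ν {-t} := by
  have hq1' : 0 ≤ 1 - q := sub_nonneg.mpr hq1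
  let a := t * (1 - q) / q
  let ν : Measure ℝ := ENNReal.ofReal q • Measure.dirac a +
    ENNReal.ofReal (1 - q) • Measure.dirac (-t)
  have hint (f : ℝ → ℝ) (r b : ℝ) : Integrable f (ENNReal.ofReal r • Measure.dirac b) :=
    (integrable_dirac enorm_lt_top).smul_measure ENNReal.ofReal_ne_top
  have hν (f : ℝ → ℝ) : ∫ ω, f ω ∂ν = q * f a + (1 - q) * f (-t) := by
    rw [integral_add_measure (hint f _ _) (hint f _ _), integral_smul_measure,
      integral_smul_measure, integral_dirac, integral_dirac, ENNReal.toReal_ofReal hq0.le,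
      ENNReal.toReal_ofReal hq1', smul_eq_mul, smul_eq_mul]
  refine ⟨ν, ⟨?_⟩, ?_, (hν fun ω => ω).trans ?_, (hν fun ω => ω ^ 2).trans_le ?_, ?_⟩
  · simp [ν, ← ENNReal.ofReal_add hq0.le hq1']
  · exact (memLp_two_iff_integrable_sq measurable_id.aestronglyMeasurable).mpr
      (integrable_add_measure.mpr ⟨hint _ _ _, hint _ _ _⟩)
  · simp only [a]
    field_simp
    ring
  · have hvar : q * a ^ 2 + (1 - q) * (-t) ^ 2 = t ^ 2 / q * (1 - q) := by
      simp only [a]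
      field_simp
      ring
    rw [hvar]
    exact mul_le_of_le_one_right (by positivity) (sub_le_self _ hq0.le)
  · simp [ν]

theorem exists_centered_law_atom_pow {n : ℕ} (hn : 0 < n) (t : ℝ) :
    ∃ ν : Measure ℝ, IsProbabilityMeasure ν ∧ MemLp id 2 ν ∧ ∫ ω, ω ∂ν = 0 ∧
      ∫ ω, ω ^ 2 ∂ν ≤ 2 * (n * t ^ 2) ∧ ENNReal.ofReal (1 / 2) ≤ ν {-t} ^ n := by
  have hn1 : (1 : ℝ) ≤ n := by exact_mod_cast hn
  let q := 1 / (2 * n : ℝ)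
  have hq1 : q ≤ 1 := div_le_one_of_le₀ (by linarith) (by positivity)
  have hbernoulli : 1 / 2 ≤ (1 - q) ^ n := by
    calc (1 / 2 : ℝ) = 1 + n * -q := by simp only [q]; field_simp; norm_num
      _ ≤ (1 + -q) ^ n := one_add_mul_le_pow (by linarith) n
      _ = (1 - q) ^ n := by rw [← sub_eq_add_neg]
  obtain ⟨ν, hν, hν2, hmean, hsq, hatom⟩ := exists_centered_law_atom (q := q) (by positivity) hq1 t
  refine ⟨ν, hν, hν2, hmean, hsq.trans_eq ?_, (ENNReal.ofReal_le_ofReal hbernoulli).trans ?_⟩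
  · rw [div_div_eq_mul_div, div_one]
    ring
  · rw [ENNReal.ofReal_pow (sub_nonneg.mpr hq1)]
    gcongr

section ObsLaw

variable {d n : ℕ} {p : Fin d → ℕ} (x : ∀ k, Fin (p k) → ℝ) (v : ℝ≥0) (μ : (Fin d → ℝ) → ℝ)

theorem signalLaw_zero_map_add {J : Type*} [Fintype J] (θ : J → ℝ) :
    (signalLaw n v (0 : J → ℝ)).map (fun y i j => θ j + y i j) = signalLaw n v θ := by
  have hshift : Measurable fun (y : J → ℝ) j => θ j + y j := by fun_prop
  have hrow : (Measure.pi fun _ : J => gaussianReal 0 v).map (fun y j => θ j + y j) =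
      Measure.pi fun j => gaussianReal (θ j) v := by
    rw [Measure.pi_map_pi (f := fun j t => θ j + t) fun j => by fun_prop]
    simp only [gaussianReal_map_const_add, zero_add]
  have hσ : SigmaFinite ((Measure.pi fun _ : J => gaussianReal 0 v).map
      fun y j => θ j + y j) := by
    rw [hrow]
    infer_instance
  rw [signalLaw_zero, Measure.pi_map_pi (f := fun (_ : Fin n) (y : J → ℝ) j => θ j + y j)
    fun _ => hshift.aemeasurable, hrow, signalLaw]

theorem smul_signalLaw_le_obsLaw_constField (ν : Measure ℝ) [IsProbabilityMeasure ν] (b : ℝ) :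
    ν {b} ^ n • signalLaw n v (fun j : GridIndex p => μ (gridPoint x j) + b) ≤
      obsLaw n x v μ (constField d ν) := by
  refine Measure.le_iff.mpr fun s hs => ?_
  have hshift : Measurable fun (y : Fin n → GridIndex p → ℝ) i j =>
      μ (gridPoint x j) + b + y i j := by fun_prop
  have hobs : Measurable fun (r : (Fin n → ℝ) × (Fin n → GridIndex p → ℝ)) i j =>
      μ (gridPoint x j) + r.1 i + r.2 i j := by fun_prop
  have hatom : (Measure.pi fun _ : Fin n => ν) (Set.univ.pi fun _ => {b}) = ν {b} ^ n := by
    rw [Measure.pi_pi, Finset.prod_const, Finset.card_univ, Fintype.card_fin]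
  rw [Measure.smul_apply, smul_eq_mul, ← signalLaw_zero_map_add, Measure.map_apply hshift hs,
    ← hatom, signalLaw_zero, ← Measure.prod_prod, obsLaw]
  refine (measure_mono ?_).trans_eq (Measure.map_apply hobs hs).symm
  rintro ⟨ω, y⟩ ⟨hω, hy⟩
  obtain rfl : ω = fun _ => b := funext fun i => hω i trivial
  exact hy

theorem signalLaw_le_obsLaw_constField_dirac_zero :
    signalLaw n v (fun j : GridIndex p => μ (gridPoint x j)) ≤
      obsLaw n x v μ (constField d (Measure.dirac 0)) := by
  simpa using smul_signalLaw_le_obsLaw_constField x v μ (Measure.dirac 0) 0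

end ObsLaw

/-! ### Lower bounds for the maximal risk of an estimator -/

section MaxRisk

variable {d n : ℕ} {p : Fin d → ℕ} {α L β₀ C_Z : ℝ} {v : ℝ≥0} {x : ∀ k, Fin (p k) → ℝ}
  {m : Obs n p → (Fin d → ℝ) → ℝ}

/-- The maximal risk of the estimator `m` over the Hölder class and the class of random fields,
not normalised by the rate. -/
def maxRisk (α L β₀ C_Z : ℝ) (v : ℝ≥0) (x : ∀ k, Fin (p k) → ℝ)
    (m : Obs n p → (Fin d → ℝ) → ℝ) : ℝ≥0∞ :=
  ⨆ μ ∈ holderClass d α L, ⨆ Z ∈ processClass d β₀ C_Z,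
    ∫⁻ y, supDist (m y) μ ∂(obsLaw n x v μ Z)

theorem enorm_sub_le_supDist (f g : (Fin d → ℝ) → ℝ) {z : Fin d → ℝ} (hz : z ∈ cube d) :
    ‖f z - g z‖ₑ ≤ supDist f g :=
  le_iSup₂_of_le (f := fun x (_ : x ∈ cube d) => ‖f x - g x‖ₑ) z hz le_rfl

theorem lintegral_supDist_le_maxRisk {μ : (Fin d → ℝ) → ℝ} (hμ : μ ∈ holderClass d α L)
    {Z : RandomField d} (hZ : Z ∈ processClass d β₀ C_Z) (m : Obs n p → (Fin d → ℝ) → ℝ) :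
    ∫⁻ y, supDist (m y) μ ∂(obsLaw n x v μ Z) ≤ maxRisk α L β₀ C_Z v x m :=
  le_iSup₂_of_le μ hμ (le_iSup₂_of_le Z hZ le_rfl)

-- An estimator that is within `δ / 2` of `0` at every `z k` is off by `δ / 2` under every `μ k`.
theorem mul_measure_univ_le_maxRisk (hα : 0 < α) (hL : 0 ≤ L) (hβ : β₀ ≤ 1) (hC : 0 < C_Z)
    (hm : m ∈ estimators n p) {ι : Type*} [Fintype ι] {w : ι → ℝ≥0∞} (hw : ∑ k, w k ≤ 1)
    {μ : ι → (Fin d → ℝ) → ℝ} (hμ : ∀ k, μ k ∈ holderClass d α L)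
    {Z : ι → RandomField d} (hZ : ∀ k, Z k ∈ processClass d β₀ C_Z)
    {z : ι → Fin d → ℝ} (hz : ∀ k, z k ∈ cube d) {δ : ℝ≥0∞} (hδ : ∀ k, δ ≤ ‖μ k (z k)‖ₑ)
    {ν : Measure (Obs n p)} (hν0 : ν ≤ signalLaw n v 0)
    (hν : ν ≤ ∑ k, w k • obsLaw n x v (μ k) (Z k)) :
    δ * ν Set.univ ≤ 2 * maxRisk α L β₀ C_Z v x m := by
  have hrisk0 : ∫⁻ y, ⨆ k, ‖m y (z k)‖ₑ ∂obsLaw n x v 0 (constField d (Measure.dirac 0)) ≤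
      maxRisk α L β₀ C_Z v x m := by
    refine (lintegral_mono fun y => iSup_le fun k => ?_).trans (lintegral_supDist_le_maxRisk
      (zero_mem_holderClass hα hL) (constField_dirac_zero_mem_processClass hβ hC) m)
    simpa only [Pi.zero_apply, sub_zero] using enorm_sub_le_supDist (m y) 0 (hz k)
  have hloss (k : ι) (y : Obs n p) : δ - ⨆ k, ‖m y (z k)‖ₑ ≤ supDist (m y) (μ k) := by
    refine tsub_le_iff_left.mpr ((hδ k).trans ?_)
    calc ‖μ k (z k)‖ₑ = ‖m y (z k) - (m y (z k) - μ k (z k))‖ₑ := by rw [sub_sub_cancel]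
      _ ≤ ‖m y (z k)‖ₑ + ‖m y (z k) - μ k (z k)‖ₑ := enorm_sub_le
      _ ≤ _ := add_le_add (le_iSup (fun k => ‖m y (z k)‖ₑ) k) (enorm_sub_le_supDist _ _ (hz k))
  have hrisk : ∫⁻ y, (δ - ⨆ k, ‖m y (z k)‖ₑ) ∂(∑ k, w k • obsLaw n x v (μ k) (Z k)) ≤
      maxRisk α L β₀ C_Z v x m := by
    rw [lintegral_finsetSum_measure]
    simp only [lintegral_smul_measure, smul_eq_mul]
    calc _ ≤ ∑ k, w k * maxRisk α L β₀ C_Z v x m := by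
          gcongr with k
          exact (lintegral_mono (hloss k)).trans (lintegral_supDist_le_maxRisk (hμ k) (hZ k) m)
      _ ≤ _ := by
          rw [← Finset.sum_mul]
          exact mul_le_of_le_one_left' hw
  exact le_of_common_part (hν0.trans (signalLaw_le_obsLaw_constField_dirac_zero x v 0)) hν
    (Measurable.iSup fun k => (hm _ (hz k)).enorm) (fun _ => le_add_tsub) hrisk0 hrisk

theorem le_maxRisk_of_smul_signalLaw_le (hα : 0 < α) (hL : 0 ≤ L) (hβ : β₀ ≤ 1) (hC : 0 < C_Z)
    (hm : m ∈ estimators n p) {μ : (Fin d → ℝ) → ℝ} (hμ : μ ∈ holderClass d α L)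
    {Z : RandomField d} (hZ : Z ∈ processClass d β₀ C_Z) {z : Fin d → ℝ} (hz : z ∈ cube d)
    {r : ℝ} (hr0 : 0 ≤ r) (hr1 : r ≤ 1)
    (hν : ENNReal.ofReal r • signalLaw n v 0 ≤ obsLaw n x v μ Z) :
    ENNReal.ofReal (r / 2 * μ z) ≤ maxRisk α L β₀ C_Z v x m := by
  have hν0 : ENNReal.ofReal r • signalLaw n v (0 : GridIndex p → ℝ) ≤ signalLaw n v 0 :=
    Measure.le_iff.mpr fun s _ => mul_le_of_le_one_left' (ENNReal.ofReal_le_one.mpr hr1)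
  have h := mul_measure_univ_le_maxRisk (ι := Unit) (w := 1) hα hL hβ hC hm (by simp)
    (fun _ => hμ) (fun _ => hZ) (fun _ => hz) (fun _ => le_rfl) hν0 (by simpa using hν)
  rw [Measure.smul_apply, measure_univ, smul_eq_mul, mul_one] at h
  rw [div_mul_eq_mul_div, ENNReal.ofReal_div_of_pos two_pos, ENNReal.ofReal_ofNat,
    ENNReal.ofReal_mul hr0]
  refine ENNReal.div_le_of_le_mul' (le_trans ?_ h)
  rw [mul_comm]
  gcongr
  exact Real.ofReal_le_enorm _

-- A rare large value of the field masks a shift of the mean of order `n ^ (-1/2)`.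
theorem exists_le_maxRisk_parametric (d : ℕ) (hα : 0 < α) (hL : 0 < L) (hβ : β₀ ≤ 1)
    (hC : 0 < C_Z) : ∃ c : ℝ, 0 < c ∧ ∀ (n : ℕ) (p : Fin d → ℕ) (x : ∀ k, Fin (p k) → ℝ)
      (v : ℝ≥0), 0 < n → ∀ m ∈ estimators n p,
        ENNReal.ofReal (c * (n : ℝ) ^ (-(1 / 2) : ℝ)) ≤ maxRisk α L β₀ C_Z v x m := by
  let c₁ := min (√C_Z / 2) (L / (d + 3))
  have hc₁ : 0 < c₁ := lt_min (by positivity) (by positivity)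
  refine ⟨c₁ / 4, by positivity, fun n p x v hn m hm => ?_⟩
  have hn1 : (1 : ℝ) ≤ n := by exact_mod_cast hn
  let t := c₁ * (n : ℝ) ^ (-(1 / 2) : ℝ)
  have ht2 : 2 * (n * t ^ 2) ≤ C_Z / 2 := by
    calc 2 * (n * t ^ 2) = 2 * c₁ ^ 2 := by
          rw [mul_pow, ← Real.rpow_mul_natCast n.cast_nonneg]
          norm_num [Real.rpow_neg_one]
          field_simp
      _ ≤ 2 * (√C_Z / 2) ^ 2 := by gcongr; exact min_le_left _ _
      _ = C_Z / 2 := by rw [div_pow, Real.sq_sqrt hC.le]; ring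
  have htL : t * (d + 3) ≤ L := by
    have : t ≤ c₁ := mul_le_of_le_one_right hc₁.le
      (Real.rpow_le_one_of_one_le_of_nonpos hn1 (by norm_num))
    exact (le_div_iff₀ (by positivity)).mp (this.trans (min_le_right _ _))
  obtain ⟨ν, hν, hν2, hmean, hsq, hatom⟩ := exists_centered_law_atom_pow hn t
  have hmask : ENNReal.ofReal (1 / 2) • signalLaw n v (0 : GridIndex p → ℝ) ≤
      obsLaw n x v (fun _ => t) (constField d ν) := by
    refine le_trans (Measure.le_iff.mpr fun s _ => ?_)
      (smul_signalLaw_le_obsLaw_constField x v (fun _ => t) ν (-t))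
    simp only [add_neg_cancel, Measure.smul_apply, smul_eq_mul]
    exact mul_le_mul_left hatom _
  convert le_maxRisk_of_smul_signalLaw_le hα hL.le hβ hC hm
    (const_mem_holderClass hα (by positivity) htL)
    (constField_mem_processClass hβ hC hν2 hmean (hsq.trans ht2))
    (z := 0) ⟨le_rfl, zero_le_one⟩ one_half_pos.le one_half_lt_one.le hmask using 2
  simp only [t]
  ring

theorem exists_forall_notMem_Ioo {J : Type*} [Fintype J] {N : ℕ} (hN : Fintype.card J < N)
    (y : J → ℝ) : ∃ i : Fin N, ∀ j, y j ∉ Set.Ioo ((i : ℕ) : ℝ) ((i : ℕ) + 1) := by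
  by_contra! h
  choose j hj using h
  obtain ⟨i, i', hne, heq⟩ := Fintype.exists_ne_map_eq_of_card_lt j (by simpa using hN)
  exact hne (Fin.ext (natCast_eq_of_mem_Ioo (hj i) (heq ▸ hj i')))

-- One of the `p k + 1` slabs orthogonal to the direction `k` contains no design point inside.
theorem exists_le_maxRisk_discretisation (d : ℕ) (hα : 0 < α) (hL : 0 < L) (hβ : β₀ ≤ 1)
    (hC : 0 < C_Z) : ∃ c : ℝ, 0 < c ∧ ∀ (n : ℕ) (p : Fin d → ℕ) (x : ∀ k, Fin (p k) → ℝ)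
      (v : ℝ≥0) (k : Fin d), 0 < p k → ∀ m ∈ estimators n p,
        ENNReal.ofReal (c * (p k : ℝ) ^ (-α)) ≤ maxRisk α L β₀ C_Z v x m := by
  obtain ⟨c₀, hc₀, hmem⟩ := exists_cellBump_mem_holderClass (d := d) hα hL
  refine ⟨c₀ / 2 * 2 ^ (-α), by positivity, fun n p x v k hk m hm => ?_⟩
  let N := p k + 1
  obtain ⟨i, hi⟩ := exists_forall_notMem_Ioo (N := N) (by simp [N]) fun l => (N : ℝ) * x k l
  let q : Fin d → Fin N := fun _ => i
  let μ : (Fin d → ℝ) → ℝ := fun z => c₀ * (N : ℝ) ^ (-α) * cellBump N q z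
  have hinvisible : ENNReal.ofReal 1 • signalLaw n v (0 : GridIndex p → ℝ) ≤
      obsLaw n x v μ (constField d (Measure.dirac 0)) := by
    have hμ : (0 : GridIndex p → ℝ) = fun j => μ (gridPoint x j) := funext fun j =>
      (mul_eq_zero_of_right _ (cellBump_eq_zero (q := q) k (hi (j k)))).symm
    rw [ENNReal.ofReal_one, one_smul, hμ]
    exact signalLaw_le_obsLaw_constField_dirac_zero x v μ
  have hrisk := le_maxRisk_of_smul_signalLaw_le hα hL.le hβ hC hm
    (hmem c₀ hc₀.le le_rfl N (Nat.succ_pos _) q) (constField_dirac_zero_mem_processClass hβ hC)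
    (cellCenter_mem_cube q) zero_le_one le_rfl hinvisible
  rw [cellBump_cellCenter (Nat.succ_pos _), mul_one] at hrisk
  refine (ENNReal.ofReal_le_ofReal ?_).trans hrisk
  have hNk : (N : ℝ) ≤ 2 * p k := by exact_mod_cast (by lia : N ≤ 2 * p k)
  calc c₀ / 2 * 2 ^ (-α) * (p k : ℝ) ^ (-α) = c₀ / 2 * (2 * p k) ^ (-α) := by
        rw [Real.mul_rpow zero_le_two (Nat.cast_nonneg _), mul_assoc]
    _ ≤ c₀ / 2 * (N : ℝ) ^ (-α) := by
        gcongr ?_ * ?_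
        exact Real.rpow_le_rpow_of_nonpos (by positivity) hNk (neg_nonpos.mpr hα.le)
    _ = 1 / 2 * (c₀ * (N : ℝ) ^ (-α)) := by ring

theorem le_maxRisk_of_orthogonal_signals (hα : 0 < α) (hL : 0 ≤ L) (hβ : β₀ ≤ 1) (hC : 0 < C_Z)
    (hv : v ≠ 0) (hm : m ∈ estimators n p) {ι : Type*} [Fintype ι] [Nonempty ι]
    {μ : ι → (Fin d → ℝ) → ℝ} (hμ : ∀ k, μ k ∈ holderClass d α L)
    {z : ι → Fin d → ℝ} (hz : ∀ k, z k ∈ cube d) {δ : ℝ} (hδ : ∀ k, δ ≤ μ k (z k))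
    (horth : ∀ k l, k ≠ l → ∑ j : GridIndex p, μ k (gridPoint x j) * μ l (gridPoint x j) = 0)
    (hexp : ∀ k, Real.exp (n * (∑ j : GridIndex p, μ k (gridPoint x j) ^ 2) / v) ≤
      Fintype.card ι) : ENNReal.ofReal (δ / 4) ≤ maxRisk α L β₀ C_Z v x m := by
  let θ (k : ι) (j : GridIndex p) : ℝ := μ k (gridPoint x j)
  let w : ι → ℝ≥0∞ := fun _ => (Fintype.card ι : ℝ≥0∞)⁻¹
  have hcard : (Fintype.card ι : ℝ≥0∞) ≠ 0 := by exact_mod_cast Fintype.card_ne_zero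
  have hw : ∑ k, w k = 1 := by
    rw [Finset.sum_const, Finset.card_univ, nsmul_eq_mul,
      ENNReal.mul_inv_cancel hcard (ENNReal.natCast_ne_top _)]
  obtain ⟨ν, hν0, hν, hmass⟩ := exists_common_part_mixture (P := signalLaw n v 0)
    (fun k => measurable_signalRatio (θ k)) hw (fun k => lintegral_signalRatio hv (θ k))
    (fun k l hkl => by simp [lintegral_signalRatio_mul hv, θ, horth k l hkl]) fun k => by
      rw [lintegral_signalRatio_mul hv, ← ENNReal.div_eq_inv_mul]
      refine ENNReal.div_le_of_le_mul ?_
      rw [one_mul, ← ENNReal.ofReal_natCast]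
      simpa only [θ, ← pow_two] using ENNReal.ofReal_le_ofReal (hexp k)
  simp only [signalLaw_zero_withDensity_signalRatio hv] at hν
  have h := mul_measure_univ_le_maxRisk hα hL hβ hC hm hw.le hμ
    (fun _ => constField_dirac_zero_mem_processClass hβ hC) hz
    (fun k => (ENNReal.ofReal_le_ofReal (hδ k)).trans (Real.ofReal_le_enorm _)) hν0
    (hν.trans (Finset.sum_le_sum fun k _ =>
      smul_mono_right (w k) (signalLaw_le_obsLaw_constField_dirac_zero x v (μ k))))
  have hδ2 : ENNReal.ofReal δ * 2⁻¹ ≤ 2 * maxRisk α L β₀ C_Z v x m :=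
    (mul_le_mul_right hmass _).trans h
  rw [show δ / 4 = δ * 2⁻¹ / 2 by ring, ENNReal.ofReal_div_of_pos two_pos,
    ENNReal.ofReal_mul' (by norm_num), ENNReal.ofReal_inv_of_pos two_pos, ENNReal.ofReal_ofNat]
  exact ENNReal.div_le_of_le_mul' hδ2

theorem exists_finset_forall_mul_card_le {ι : Type*} [Fintype ι] {S : ι → ℝ}
    (hS : ∀ q, 0 ≤ S q) {T : ℝ} (hT : 0 < T) (hST : ∑ q, S q ≤ T) :
    ∃ G : Finset ι, Fintype.card ι ≤ 2 * G.card ∧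
      ∀ q ∈ G, S q * Fintype.card ι ≤ 2 * T := by
  classical
  let G : Finset ι := {q | S q * Fintype.card ι ≤ 2 * T}
  have hmarkov : (Gᶜ.card : ℝ) * (2 * T) ≤ Fintype.card ι * T := by
    calc (Gᶜ.card : ℝ) * (2 * T) ≤ ∑ q ∈ Gᶜ, S q * Fintype.card ι := by
          rw [← nsmul_eq_mul]
          refine Finset.card_nsmul_le_sum _ _ _ fun q hq => ?_
          simp only [G, Finset.compl_filter, Finset.mem_filter_univ, not_le] at hq
          exact hq.le
      _ = Fintype.card ι * ∑ q ∈ Gᶜ, S q := by rw [← Finset.sum_mul, mul_comm]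
      _ ≤ Fintype.card ι * T := by
          gcongr
          exact (Finset.sum_le_univ_sum_of_nonneg hS).trans hST
  have hcompl : 2 * Gᶜ.card ≤ Fintype.card ι := by
    have : (2 * Gᶜ.card : ℝ) ≤ Fintype.card ι := by nlinarith
    exact_mod_cast this
  exact ⟨G, by have := G.card_add_card_compl; lia, fun q hq => (Finset.mem_filter_univ q).mp hq⟩

theorem le_maxRisk_of_cellBump_mem_holderClass (hα : 0 < α) (hL : 0 ≤ L) (hβ : β₀ ≤ 1)
    (hC : 0 < C_Z) (hv : v ≠ 0) (hp : 0 < ∏ k, (p k : ℝ)) (hm : m ∈ estimators n p) {N : ℕ}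
    (hN : 0 < N) {a : ℝ} (hmem : ∀ q, (fun z => a * cellBump N q z) ∈ holderClass d α L)
    (hexp : Real.exp (n * (a ^ 2 * (2 * ∏ k, (p k : ℝ)) / N ^ d) / v) ≤ N ^ d / 2) :
    ENNReal.ofReal (a / 4) ≤ maxRisk α L β₀ C_Z v x m := by
  have hNd : (0 : ℝ) < N ^ d := by positivity
  have henergy : ∑ q : Fin d → Fin N, ∑ j : GridIndex p, cellBump N q (gridPoint x j) ^ 2 ≤
      ∏ k, (p k : ℝ) := by
    rw [Finset.sum_comm]
    calc _ ≤ ∑ _ : GridIndex p, (1 : ℝ) :=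
          Finset.sum_le_sum fun j _ => sum_cellBump_sq_le_one N (gridPoint x j)
      _ = ∏ k, (p k : ℝ) := by simp
  obtain ⟨G, hcard, hG⟩ := exists_finset_forall_mul_card_le
    (fun q => Finset.sum_nonneg fun j _ => sq_nonneg (cellBump N q (gridPoint x j))) hp henergy
  rw [Fintype.card_pi, Finset.prod_const, Finset.card_univ, Fintype.card_fin, Fintype.card_fin]
    at hcard
  simp only [Fintype.card_pi_const, Fintype.card_fin, Nat.cast_pow] at hG
  have hcardG : (N : ℝ) ^ d / 2 ≤ Fintype.card G := by
    rw [Fintype.card_coe, div_le_iff₀' two_pos]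
    exact_mod_cast hcard
  have : Nonempty G := Fintype.card_pos_iff.mp (by exact_mod_cast (half_pos hNd).trans_le hcardG)
  refine le_maxRisk_of_orthogonal_signals hα hL hβ hC hv hm (fun q : G => hmem q)
    (fun q => cellCenter_mem_cube (q : Fin d → Fin N)) (fun q => ?_) (fun q q' hne => ?_)
    fun q => ?_
  · rw [cellBump_cellCenter hN, mul_one]
  · refine Finset.sum_eq_zero fun j _ => ?_
    rw [mul_mul_mul_comm, cellBump_mul_cellBump_of_ne (Subtype.coe_ne_coe.mpr hne), mul_zero]
  · refine (Real.exp_le_exp.mpr ?_).trans (hexp.trans hcardG)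
    simp_rw [mul_pow, ← Finset.mul_sum]
    rw [mul_div_assoc (a ^ 2)]
    gcongr
    exact (le_div_iff₀ hNd).mpr (hG q q.2)

theorem eventually_two_mul_rpow_le {τ : ℝ} (hτ : 0 < τ) :
    ∀ᶠ M : ℝ in atTop, 2 * M ^ (1 / (2 * τ)) ≤ (M / Real.log M) ^ (1 / τ) := by
  have hlog := (isLittleO_log_rpow_atTop (r := 1 / 2) one_half_pos).bound
    (c := (2 : ℝ) ^ (-τ)) (by positivity)
  filter_upwards [hlog, eventually_gt_atTop 1] with M hM hM1
  have hM0 : 0 < M := one_pos.trans hM1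
  have hlog0 : 0 < Real.log M := Real.log_pos hM1
  rw [Real.norm_of_nonneg hlog0.le, Real.norm_of_nonneg (by positivity)] at hM
  have hratio : 2 ^ τ * M ^ (1 / 2 : ℝ) ≤ M / Real.log M := by
    rw [le_div_iff₀ hlog0]
    calc 2 ^ τ * M ^ (1 / 2 : ℝ) * Real.log M
        ≤ 2 ^ τ * M ^ (1 / 2 : ℝ) * (2 ^ (-τ) * M ^ (1 / 2 : ℝ)) := by gcongr
      _ = (2 ^ τ * 2 ^ (-τ)) * (M ^ (1 / 2 : ℝ) * M ^ (1 / 2 : ℝ)) := by ring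
      _ = M := by
        rw [← Real.rpow_add two_pos, ← Real.rpow_add hM0]
        norm_num
  calc 2 * M ^ (1 / (2 * τ)) = (2 ^ τ * M ^ (1 / 2 : ℝ)) ^ (1 / τ) := by
        rw [Real.mul_rpow (by positivity) (by positivity), ← Real.rpow_mul zero_le_two,
          ← Real.rpow_mul hM0.le, mul_one_div_cancel hτ.ne', Real.rpow_one, one_div_mul_one_div]
    _ ≤ _ := by gcongr

theorem eventually_exists_cellCount {d : ℕ} (hd : 1 ≤ d) (hα : 0 < α) {κ : ℝ} (hκ : 0 ≤ κ)
    (hκ' : κ ≤ 1 / (2 * (2 * α + d))) : ∀ᶠ M : ℝ in atTop, ∃ N : ℕ, 0 < N ∧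
      (N : ℝ) ≤ 2 * (M / Real.log M) ^ (1 / (2 * α + d)) ∧
      Real.exp (κ * (M * ((N : ℝ) ^ (-α)) ^ 2 / N ^ d)) ≤ N ^ d / 2 := by
  let τ : ℝ := 2 * α + d
  have hτ : 0 < τ := by positivity
  filter_upwards [eventually_two_mul_rpow_le hτ, eventually_gt_atTop 1] with M hM hM1
  have hM0 : 0 < M := one_pos.trans hM1
  have hlog : 0 < Real.log M := Real.log_pos hM1
  let R := (M / Real.log M) ^ (1 / τ)
  have hR1 : 1 ≤ R := by linarith [Real.one_le_rpow hM1.le (by positivity : 0 ≤ 1 / (2 * τ))]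
  let N := ⌈R⌉₊
  have hRN : R ≤ N := Nat.le_ceil R
  have hN1 : (1 : ℝ) ≤ N := hR1.trans hRN
  have hsignal : M * ((N : ℝ) ^ (-α)) ^ 2 / N ^ d ≤ Real.log M := by
    calc M * ((N : ℝ) ^ (-α)) ^ 2 / N ^ d = M / N ^ τ := by
          rw [Real.rpow_add (by positivity), Real.rpow_natCast, mul_comm 2 α,
            Real.rpow_mul (by positivity), Real.rpow_neg (by positivity), Real.rpow_two]
          field_simp
      _ ≤ M / R ^ τ := by gcongr
      _ = Real.log M := by
          rw [← Real.rpow_mul (by positivity), one_div_mul_cancel hτ.ne', Real.rpow_one,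
            div_div_cancel₀ hM0.ne']
  refine ⟨N, by exact_mod_cast hN1, by linarith [Nat.ceil_lt_add_one (zero_le_one.trans hR1)], ?_⟩
  calc _ ≤ Real.exp (Real.log M * (1 / (2 * τ))) := by
        rw [mul_comm κ]
        gcongr
    _ = M ^ (1 / (2 * τ)) := (Real.rpow_def_of_pos hM0 _).symm
    _ ≤ N / 2 := by linarith
    _ ≤ N ^ d / 2 := by
        gcongr
        exact le_self_pow₀ hN1 (by lia)

theorem exists_eventually_le_maxRisk_stochastic {d : ℕ} (hd : 1 ≤ d) (hα : 0 < α) (hL : 0 < L)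
    (hβ : β₀ ≤ 1) (hC : 0 < C_Z) (hv : v ≠ 0) : ∃ c : ℝ, 0 < c ∧ ∀ᶠ M : ℝ in atTop,
      ∀ (n : ℕ) (p : Fin d → ℕ) (x : ∀ k, Fin (p k) → ℝ), n * ∏ k, (p k : ℝ) = M →
        ∀ m ∈ estimators n p,
          ENNReal.ofReal (c * (Real.log M / M) ^ (α / (2 * α + d))) ≤
            maxRisk α L β₀ C_Z v x m := by
  obtain ⟨c₀, hc₀, hmem⟩ := exists_cellBump_mem_holderClass (d := d) hα hL
  have hv0 : (0 : ℝ) < v := NNReal.coe_pos.mpr (pos_iff_ne_zero.mpr hv)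
  let γ : ℝ := 1 / (2 * (2 * α + d))
  let c := min c₀ √(γ * v / 2)
  have hc : 0 < c := lt_min hc₀ (by positivity)
  have hcγ : 2 * c ^ 2 / v ≤ γ := by
    have : c ^ 2 ≤ γ * v / 2 := (Real.le_sqrt' hc).mp (min_le_right _ _)
    rw [div_le_iff₀ hv0]
    linarith
  refine ⟨c / 4 * 2 ^ (-α), by positivity, ?_⟩
  filter_upwards [eventually_exists_cellCount hd hα (by positivity) hcγ, eventually_gt_atTop 1]
    with M ⟨N, hN, hNle, hexp⟩ hM n p x hnp m hm
  have hM0 : 0 < M := one_pos.trans hM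
  have hratio : 0 < M / Real.log M := div_pos hM0 (Real.log_pos hM)
  have hprod : 0 < ∏ k, (p k : ℝ) := pos_of_mul_pos_right (hnp ▸ hM0) n.cast_nonneg
  have hrisk := le_maxRisk_of_cellBump_mem_holderClass (x := x) hα hL.le hβ hC hv hprod hm hN
    (hmem c hc.le (min_le_left _ _) N hN) <| hexp.trans_eq' <| by
      rw [← hnp]
      ring_nf
  refine (ENNReal.ofReal_le_ofReal ?_).trans hrisk
  calc c / 4 * 2 ^ (-α) * (Real.log M / M) ^ (α / (2 * α + d))
      = c / 4 * (2 * (M / Real.log M) ^ (1 / (2 * α + d))) ^ (-α) := by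
        rw [Real.mul_rpow zero_le_two (by positivity), ← Real.rpow_mul hratio.le,
          ← inv_div M, Real.inv_rpow hratio.le, ← Real.rpow_neg hratio.le]
        ring_nf
    _ ≤ c / 4 * (N : ℝ) ^ (-α) := by
        gcongr ?_ * ?_
        exact Real.rpow_le_rpow_of_nonpos (by positivity) hNle (neg_nonpos.mpr hα.le)
    _ = c * (N : ℝ) ^ (-α) / 4 := by ring

end MaxRisk

/-! ### The minimax risk -/

theorem ofReal_le_minimaxRisk {d n : ℕ} {p : Fin d → ℕ} {α L β₀ C_Z c : ℝ} {v : ℝ≥0}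
    {x : ∀ k, Fin (p k) → ℝ} (hrate : 0 < rate α n p)
    (h : ∀ m ∈ estimators n p, ENNReal.ofReal (c * rate α n p) ≤ maxRisk α L β₀ C_Z v x m) :
    ENNReal.ofReal c ≤ minimaxRisk α L β₀ C_Z v n p x := by
  have hr0 : ENNReal.ofReal (rate α n p) ≠ 0 := (ENNReal.ofReal_pos.mpr hrate).ne'
  refine le_iInf₂ fun m hm => ?_
  simp_rw [lintegral_const_mul' _ _ (ENNReal.inv_ne_top.mpr hr0), ← ENNReal.mul_iSup]
  calc ENNReal.ofReal c = (ENNReal.ofReal (rate α n p))⁻¹ * ENNReal.ofReal (c * rate α n p) := by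
        rw [ENNReal.ofReal_mul' hrate.le, mul_left_comm,
          ENNReal.inv_mul_cancel hr0 ENNReal.ofReal_ne_top, mul_one]
    _ ≤ (ENNReal.ofReal (rate α n p))⁻¹ * maxRisk α L β₀ C_Z v x m := by gcongr; exact h m hm

theorem rate_pos {d n : ℕ} (hn : 0 < n) (α : ℝ) (p : Fin d → ℕ) : 0 < rate α n p :=
  lt_max_of_lt_right (lt_max_of_lt_right (Real.rpow_pos_of_pos (by exact_mod_cast hn) _))

theorem ofReal_min_mul_rate_le {d n : ℕ} (hd : 1 ≤ d) {p : Fin d → ℕ} {α c₁ c₂ c₃ : ℝ}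
    (hc : 0 ≤ min c₁ (min c₂ c₃)) {B : ℝ≥0∞}
    (h₁ : ∀ k, ENNReal.ofReal (c₁ * (p k : ℝ) ^ (-α)) ≤ B)
    (h₂ : ENNReal.ofReal (c₂ * (Real.log (n * ∏ k, (p k : ℝ)) / (n * ∏ k, (p k : ℝ))) ^
      (α / (2 * α + d))) ≤ B)
    (h₃ : ENNReal.ofReal (c₃ * (n : ℝ) ^ (-(1 / 2) : ℝ)) ≤ B) :
    ENNReal.ofReal (min c₁ (min c₂ c₃) * rate α n p) ≤ B := by
  have : Nonempty (Fin d) := ⟨⟨0, hd⟩⟩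
  obtain ⟨k, hk⟩ := exists_eq_ciInf_of_finite (f := p)
  have hlog : 0 ≤ Real.log (n * ∏ k, (p k : ℝ)) := by
    exact_mod_cast Real.log_natCast_nonneg (n * ∏ k, p k)
  have hmono {c r : ℝ} (hr : 0 ≤ r) (hle : min c₁ (min c₂ c₃) ≤ c)
      (h : ENNReal.ofReal (c * r) ≤ B) : ENNReal.ofReal (min c₁ (min c₂ c₃) * r) ≤ B :=
    (ENNReal.ofReal_le_ofReal (by gcongr)).trans h
  rw [rate, ← hk, mul_max_of_nonneg _ _ hc, mul_max_of_nonneg _ _ hc, ENNReal.ofReal_max,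
    ENNReal.ofReal_max]
  exact max_le (hmono (by positivity) (min_le_left _ _) (h₁ k)) <|
    max_le (hmono (by positivity) ((min_le_right _ _).trans (min_le_left _ _)) h₂)
      (hmono (by positivity) ((min_le_right _ _).trans (min_le_right _ _)) h₃)

end FDAMean

end

theorem theorem2_general (d : ℕ) (hd : 1 ≤ d) (α L β₀ C_Z : ℝ) (hα : 0 < α) (hL : 0 < L)
    (hβ : β₀ ≤ 1) (hC : 0 < C_Z) (v : ℝ≥0) (hv : 0 < v) :
    ∃ c : ℝ, 0 < c ∧ ∀ᶠ np : ℕ × (Fin d → ℕ) in atTop ×ˢ atTop,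
      ∀ x : ∀ k, Fin (np.2 k) → ℝ,
        ENNReal.ofReal c ≤ FDAMean.minimaxRisk α L β₀ C_Z v np.1 np.2 x := by
  obtain ⟨c₁, hc₁, h₁⟩ := FDAMean.exists_le_maxRisk_discretisation d hα hL hβ hC
  obtain ⟨c₂, hc₂, h₂⟩ :=
    FDAMean.exists_eventually_le_maxRisk_stochastic hd hα hL hβ hC hv.ne'
  obtain ⟨c₃, hc₃, h₃⟩ := FDAMean.exists_le_maxRisk_parametric d hα hL hβ hC
  obtain ⟨M₀, hM₀⟩ := eventually_atTop.mp h₂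
  have hc : 0 < min c₁ (min c₂ c₃) := lt_min hc₁ (lt_min hc₂ hc₃)
  refine ⟨min c₁ (min c₂ c₃), hc, ?_⟩
  filter_upwards [prod_mem_prod (eventually_ge_atTop (max 1 ⌈M₀⌉₊))
    (eventually_ge_atTop (fun _ : Fin d => 1))]
    with ⟨n, p⟩ ⟨(hn : max 1 ⌈M₀⌉₊ ≤ n), (hp : ∀ k, 1 ≤ p k)⟩ x
  have hn0 : 0 < n := (le_max_left _ _).trans hn
  have hM : M₀ ≤ n * ∏ k, (p k : ℝ) := by
    calc M₀ ≤ n := Nat.ceil_le.mp ((le_max_right _ _).trans hn)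
      _ ≤ n * ∏ k, (p k : ℝ) := le_mul_of_one_le_right n.cast_nonneg
          (Finset.one_le_prod fun k _ => by exact_mod_cast hp k)
  exact FDAMean.ofReal_le_minimaxRisk (FDAMean.rate_pos hn0 α p) fun m hm =>
    FDAMean.ofReal_min_mul_rate_le hd hc.le (fun k => h₁ n p x v k (hp k) m hm)
      (hM₀ _ hM n p x rfl m hm) (h₃ n p x v hn0 m hm)

theorem theorem2 (d : ℕ) (hd : 1 ≤ d) (α L β₀ C_Z : ℝ) (hα : 0 < α) (hL : 0 < L)
    (hβ₀ : 0 < β₀) (hβ₀' : β₀ ≤ 1) (hC : 0 < C_Z) (v : ℝ≥0) (hv : 0 < v)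
    (f : Fin d → ℝ → ℝ) (hf : ∀ k, FDAMean.IsDesignDensity (f k))
    (x : ∀ p : Fin d → ℕ, ∀ k, Fin (p k) → ℝ) (hx : ∀ p, FDAMean.IsDesign f p (x p)) :
    ∃ c : ℝ, 0 < c ∧
      ENNReal.ofReal c ≤
        liminf (fun np : ℕ × (Fin d → ℕ) =>
          FDAMean.minimaxRisk α L β₀ C_Z v np.1 np.2 (x np.2)) (atTop ×ˢ atTop) := by
  obtain ⟨c, hc, h⟩ := theorem2_general d hd α L β₀ C_Z hα hL hβ₀' hC v hv
  exact ⟨c, hc, le_liminf_of_le (by isBoundedDefault) (h.mono fun np hnp => hnp (x np.2))⟩
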